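/- **Setting.** Let $k$ be a field, $S=k[x_1,\dots,x_n]$ with its multigrading by monomials, and let $M\subsetneq S$ be a monomial ideal minimally generated by monomials $m_1,\dots,m_r$. Let $L_M$ be the lcm-lattice of $M$: the least common multiples of all subsets of $\{m_1,\dots,m_r\}$, ordered by divisibility; its bottom element is $1$ and its atoms are $m_1,\dots,m_r$. For $m\in L_M$ put $A_m=\{i : m_i \text{ divides } m\}$. For $m\ne 1$ in $L_M$ let $\Delta_m$ be the simplicial complex generated by the faces $A_q$ for the $q$ covered by $m$ in $L_M$ (so $\Delta_{m_j}=\{\emptyset\}$). The Betti poset $B_M\subseteq L_M$ consists of $1$ and of the $m\ne1$ with $\widetilde H(\Delta_m;k)\neq0$. A *minimal free resolution* of $S/M$ is a finite complex of finitely generated multigraded free $S$-modules $(\mathbf F,\partial)$ with multigraded differentials and a fixed multigraded basis, exact in positive degrees, with cokernel $S/M$ in degree $0$ (as a multigraded module), and with $\partial(\mathbf F)\subseteq(x_1,\dots,x_n)\mathbf F$. The ideal $M$ is *Betti-linear* if $S/M$ has a minimal free resolution such that, whenever the basis element $\tilde e$ occurs in $\partial(e)$ with nonzero coefficient, $\mathrm{mdeg}(\tilde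 e)$ is covered by $\mathrm{mdeg}(e)$ in $B_M$. **The poset construction.** For $m\neq 1$ in $L_M$ let $\beta_1,\dots,\beta_l$ be the maximal elements of $\{q\in B_M : q<m\}$, let $\widetilde\Delta_m=\langle A_{\beta_1},\dots,A_{\beta_l}\rangle\subseteq\Delta_m$, and let $\sigma_m:\widetilde H(\widetilde\Delta_m;k)\to\widetilde H(\Delta_m;k)$ be induced by the inclusion. Put $\mathcal D_0=\widetilde H_{-1}(\{\emptyset\};k)$ and $\mathcal D_i=\bigoplus_{1\ne m\in L_M}\widetilde H_{i-2}(\Delta_m;k)$ for $i\ge1$. Let $\varphi_1:\mathcal D_1=\bigoplus_{j}\widetilde H_{-1}(\Delta_{m_j};k)\to\mathcal D_0$ be the identity of $\widetilde H_{-1}(\{\emptyset\};k)$ on each summand. For $i\ge2$ let $\varphi_i:\mathcal D_i\to\mathcal D_{i-1}$ have, from the summand of $m$ to the summand of $\beta_j$, the component $$\varphi_{i,m}^{\beta_j}=\iota\circ\delta\circ\sigma_m^{-1}:\widetilde H_{i-2}(\Delta_m;k)\to\widetilde H_{i-3}(\Delta_1\cap\Delta_2;k)\to\widetilde H_{i-3}(\Delta_{\beta_j};k)\qquad(\beta_j\neq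 1),$$ and all other components zero. Here $\Delta_1=\langle A_{\beta_j}\rangle$, $\Delta_2=\langle A_{\beta_s}: s\neq j\rangle$, $\delta$ is the Mayer–Vietoris connecting homomorphism of $\widetilde\Delta_m=\Delta_1\cup\Delta_2$ ($\delta[c_1-c_2]=[d c_1]$ for chains $c_1$ of $\Delta_1$ and $c_2$ of $\Delta_2$), and $\iota$ is induced by the inclusion $\Delta_1\cap\Delta_2\subseteq\Delta_{\beta_j}$. This sequence is $\mathcal D(L_M)$; it is given the basis obtained from any choice of bases of the spaces $\widetilde H_i(\Delta_m;k)$, where in $\widetilde H_{-1}(\{\emptyset\};k)$ and in the $\widetilde H_{-1}(\Delta_{m_j};k)$ the class of $\emptyset$ is chosen. Let $\mathcal F(L_M)$ be the sequence of free modules $\mathcal F_i=\mathcal D_i\otimes_k S$ with the same basis, where the basis element of $\mathcal F_0$ has multidegree $1$ and the basis elements in the summand of $m$ have multidegree $m$; its maps $\partial_i$ are obtained from $\varphi_i$ by multiplying the component from the summand of $m$ to the summand of $\beta$ by $m/\beta$ (and by $m_j$ for $i=1$). An *$r$-frame* is a finite complex $U$ of finite-dimensional $k$-vector spaces with fixed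 bases such that $U_0=k$, $U_1=k^r$ and $U_1\to U_0$ sends every basis element to the basis element of $U_0$. If the basis elements of $U_1$ are matched with $m_1,\dots,m_r$, its *$M$-homogenization* is the sequence of free $S$-modules with the same bases, in which the basis element of $U_0$ has multidegree $1$, those of $U_1$ have multidegrees $m_1,\dots,m_r$, a basis element $v$ of $U_i$ ($i\geq2$) with $d v=\sum_u\alpha_u u$ has multidegree $\mathrm{lcm}(\mathrm{mdeg}(u):\alpha_u\ne0)$, and each $v$ is mapped to $\sum_u\alpha_u\frac{\mathrm{mdeg}(v)}{\mathrm{mdeg}(u)}u$. Two sequences of multigraded free modules with fixed bases are *equal* if there is a multigraded isomorphism between them that induces a bijection of the fixed bases. **Theorem.** Let $M$ be Betti-linear. Then all the maps $\sigma_m$ are isomorphisms, so that $\mathcal D(L_M)$ is defined, and for every choice of bases as above: 1. $\mathcal D(L_M)$ is an $r$-frame; 2. $\mathcal F(L_M)$ equals the $M$-homogenization of $\mathcal D(L_M)$, where the basis element in the summand $\widetilde H_{-1}(\Delta_{m_j};k)$ of $\mathcal D_1$ is matched with $m_j$; 3. $\mathcal F(L_M)$ is a minimal free resolution of $S/M$.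 -/

import Mathlib

open scoped TensorProduct

noncomputable section

universe u

namespace PosetResolution

/-! ### Simplicial complexes on `{0, …, r-1}` and their reduced homology

A simplicial complex on the vertex set `Fin r` is a down-closed family of finite sets of vertices,
that is, a `LowerSet (Finset (Fin r))`. The empty set counts as a face, so that the complex `{∅}`
and the void complex (which has no face) are different. The complex generated by a family of faces
is its `lowerClosure`; unions and intersections of complexes are `⊔` and `⊓`. -/

section Homology

variable (k : Type u) [Field k] {r : ℕ}

/-- Chains of the full simplex on `Fin r`, the empty face included (augmented chains): a chain is
the family of its coefficients, and the face `A` is the chain `Pi.single A 1`. -/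
abbrev Chain (r : ℕ) : Type u := Finset (Fin r) → k

/-- The simplicial boundary `d A = ∑_{i ∈ A} ± (A \ {i})`, the sign being `(-1)` to the number of
elements of `A` below `i`. In particular `d {i} = ∅` and `d ∅ = 0`. -/
def boundary (r : ℕ) : Chain k r →ₗ[k] Chain k r :=
  Fintype.linearCombination k fun A : Finset (Fin r) =>
    ∑ i ∈ A, Pi.single (A.erase i) ((-1 : k) ^ (A.filter (· < i)).card)

/-- The span of the faces of `Δ` with `c` elements: the augmented chains of dimension `c - 1`. -/
def chains (Δ : LowerSet (Finset (Fin r))) (c : ℕ) : Submodule k (Chain k r) where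
  carrier := {x | ∀ A, ¬(A ∈ Δ ∧ A.card = c) → x A = 0}
  zero_mem' := fun _ _ => rfl
  add_mem' := fun hx hy A hA => by rw [Pi.add_apply, hx A hA, hy A hA, add_zero]
  smul_mem' := fun a x hx A hA => by rw [Pi.smul_apply, hx A hA, smul_zero]

/-- The cycles of `Δ` of dimension `c - 1`. -/
def cycles (Δ : LowerSet (Finset (Fin r))) (c : ℕ) : Submodule k (Chain k r) :=
  chains k Δ c ⊓ LinearMap.ker (boundary k r)

/-- The boundaries of `Δ` of dimension `c - 1`. -/
def boundaries (Δ : LowerSet (Finset (Fin r))) (c : ℕ) : Submodule k (Chain k r) :=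
  (chains k Δ (c + 1)).map (boundary k r)

/-- `RedHomology k Δ c` is the reduced simplicial homology of `Δ` with coefficients in `k` in
dimension `c - 1`, the homology at the faces with `c` elements. -/
abbrev RedHomology (Δ : LowerSet (Finset (Fin r))) (c : ℕ) : Type u :=
  ↥(cycles k Δ c) ⧸ (boundaries k Δ c).submoduleOf (cycles k Δ c)

/-- The homology class of a cycle. -/
def homologyClass (Δ : LowerSet (Finset (Fin r))) (c : ℕ) :
    ↥(cycles k Δ c) →ₗ[k] RedHomology k Δ c :=
  Submodule.mkQ _

variable {k}

theorem boundary_single (A : Finset (Fin r)) (a : k) :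
    boundary k r (Pi.single A a) =
      ∑ i ∈ A, Pi.single (A.erase i) (a * (-1 : k) ^ (A.filter (· < i)).card) := by
  rw [boundary, Fintype.linearCombination_apply_single, Finset.smul_sum]
  refine Finset.sum_congr rfl fun i _ => ?_
  rw [← Pi.single_smul, smul_eq_mul]

theorem sign_lt {A : Finset (Fin r)} {i j : Fin r} (hj : j ∈ A) (hji : j < i) :
    (-1 : k) ^ (A.filter (· < i)).card * (-1 : k) ^ ((A.erase i).filter (· < j)).card +
      (-1 : k) ^ (A.filter (· < j)).card * (-1 : k) ^ ((A.erase j).filter (· < i)).card = 0 := by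
  have h1 : (A.erase i).filter (· < j) = A.filter (· < j) := by
    ext l
    simp only [Finset.mem_filter, Finset.mem_erase]
    constructor
    · rintro ⟨⟨_, h⟩, h'⟩; exact ⟨h, h'⟩
    · rintro ⟨h, h'⟩; exact ⟨⟨(h'.trans hji).ne, h⟩, h'⟩
  have h2 : (A.erase j).filter (· < i) = (A.filter (· < i)).erase j := by
    rw [Finset.filter_erase]
  have h3 : ((A.erase j).filter (· < i)).card + 1 = (A.filter (· < i)).card := by
    rw [h2, Finset.card_erase_add_one]
    simp [hj, hji]
  rw [h1, ← h3, pow_succ]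
  ring

theorem boundary_boundary (x : Chain k r) : boundary k r (boundary k r x) = 0 := by
  suffices h : boundary k r ∘ₗ boundary k r = 0 from LinearMap.congr_fun h x
  refine LinearMap.pi_ext fun A a => ?_
  rw [LinearMap.comp_apply, boundary_single, map_sum, LinearMap.zero_apply]
  simp only [boundary_single]
  rw [Finset.sum_sigma']
  refine Finset.sum_involution (fun x _ => ⟨x.2, x.1⟩) ?_ ?_ ?_ ?_
  · rintro ⟨i, j⟩ hx
    simp only [Finset.mem_sigma, Finset.mem_erase] at hx
    obtain ⟨hi, hne, hj⟩ := hx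
    dsimp only
    rw [Finset.erase_right_comm (a := j) (b := i), ← Pi.single_add]
    rw [Pi.single_eq_zero_iff]
    rcases lt_or_gt_of_ne hne with h | h
    · have := sign_lt (k := k) hj h
      linear_combination a * this
    · have := sign_lt (k := k) hi h
      linear_combination a * this
  · rintro ⟨i, j⟩ hx _ heq
    simp only [Finset.mem_sigma, Finset.mem_erase] at hx
    exact hx.2.1 (congrArg Sigma.fst heq)
  · rintro ⟨i, j⟩ hx
    simp only [Finset.mem_sigma, Finset.mem_erase] at hx ⊢
    exact ⟨hx.2.2, fun h => hx.2.1 h.symm, hx.1⟩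
  · rintro ⟨i, j⟩ _
    rfl

theorem chains_mono {Δ Δ' : LowerSet (Finset (Fin r))} (h : Δ ≤ Δ') (c : ℕ) :
    chains k Δ c ≤ chains k Δ' c :=
  fun _ hx A hA => hx A fun h' => hA ⟨h h'.1, h'.2⟩

theorem cycles_mono {Δ Δ' : LowerSet (Finset (Fin r))} (h : Δ ≤ Δ') (c : ℕ) :
    cycles k Δ c ≤ cycles k Δ' c :=
  inf_le_inf_right _ (chains_mono h c)

theorem boundaries_mono {Δ Δ' : LowerSet (Finset (Fin r))} (h : Δ ≤ Δ') (c : ℕ) :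
    boundaries k Δ c ≤ boundaries k Δ' c :=
  Submodule.map_mono (chains_mono h _)

theorem single_mem_chains {Δ : LowerSet (Finset (Fin r))} {A : Finset (Fin r)} (hA : A ∈ Δ)
    (a : k) : (Pi.single A a : Chain k r) ∈ chains k Δ A.card := by
  intro B hB
  have hne : B ≠ A := by
    rintro rfl
    exact hB ⟨hA, rfl⟩
  simp [hne]

theorem boundary_mem_chains {Δ : LowerSet (Finset (Fin r))} {c : ℕ} {x : Chain k r}
    (hx : x ∈ chains k Δ (c + 1)) : boundary k r x ∈ chains k Δ c := by
  rw [boundary, Fintype.linearCombination_apply]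
  refine Submodule.sum_mem _ fun A _ => ?_
  by_cases hA : A ∈ Δ ∧ A.card = c + 1
  swap
  · rw [hx A hA, zero_smul]
    exact Submodule.zero_mem _
  obtain ⟨hA, hc⟩ := hA
  refine Submodule.smul_mem _ _ ?_
  refine Submodule.sum_mem _ fun i hi => ?_
  have hcard : (A.erase i).card = c := by
    rw [Finset.card_erase_of_mem hi, hc]; rfl
  rw [← hcard]
  exact single_mem_chains (Δ.lower (Finset.erase_subset i A) hA) _

variable (k) in
/-- The map on reduced homology induced by an inclusion of simplicial complexes. -/
def inclHomology {Δ Δ' : LowerSet (Finset (Fin r))} (h : Δ ≤ Δ') (c : ℕ) :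
    RedHomology k Δ c →ₗ[k] RedHomology k Δ' c :=
  Submodule.mapQ _ _ (Submodule.inclusion (cycles_mono h c)) fun _ hx => boundaries_mono h c hx

open Classical in
/-- The part of a chain carried by the faces of `Δ`. -/
def restrictTo (Δ : LowerSet (Finset (Fin r))) : Chain k r →ₗ[k] Chain k r where
  toFun x A := if A ∈ Δ then x A else 0
  map_add' x y := by
    funext A
    simp only [Pi.add_apply]
    split_ifs <;> simp
  map_smul' a x := by
    funext A
    simp

theorem restrictTo_apply (Δ : LowerSet (Finset (Fin r))) (x : Chain k r) (A : Finset (Fin r))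
    [Decidable (A ∈ Δ)] : restrictTo Δ x A = if A ∈ Δ then x A else 0 := by
  simp only [restrictTo, LinearMap.coe_mk, AddHom.coe_mk]
  congr

theorem restrictTo_mem_left {Δ Δ₁ Δ₂ : LowerSet (Finset (Fin r))} (_h : Δ ≤ Δ₁ ⊔ Δ₂) {c : ℕ}
    {x : Chain k r} (hx : x ∈ chains k Δ c) : restrictTo Δ₁ x ∈ chains k Δ₁ c := by
  classical
  intro A hA
  rw [restrictTo_apply]
  split_ifs with h1
  · exact hx A fun h => hA ⟨h1, h.2⟩
  · rfl

theorem restrictTo_sub_mem_right {Δ Δ₁ Δ₂ : LowerSet (Finset (Fin r))} (h : Δ ≤ Δ₁ ⊔ Δ₂) {c : ℕ}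
    {x : Chain k r} (hx : x ∈ chains k Δ c) : restrictTo Δ₁ x - x ∈ chains k Δ₂ c := by
  classical
  intro A hA
  rw [Pi.sub_apply, restrictTo_apply]
  split_ifs with h1
  · exact sub_self _
  · rw [zero_sub, neg_eq_zero]
    refine hx A fun h' => ?_
    rcases LowerSet.mem_sup_iff.1 (h h'.1) with h2 | h2
    · exact h1 h2
    · exact hA ⟨h2, h'.2⟩

theorem mem_chains_inf {Δ₁ Δ₂ : LowerSet (Finset (Fin r))} {c : ℕ} {x : Chain k r}
    (h₁ : x ∈ chains k Δ₁ c) (h₂ : x ∈ chains k Δ₂ c) : x ∈ chains k (Δ₁ ⊓ Δ₂) c := by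
  intro A hA
  by_cases h : A ∈ Δ₁ ∧ A.card = c
  · refine h₂ A fun h' => hA ⟨LowerSet.mem_inf_iff.2 ⟨h.1, h'.1⟩, h.2⟩
  · exact h₁ A h

/-- If a cycle `f` is `c₁ - c₂` with `c₁` a chain of `Δ₁` and `c₂` a chain of `Δ₂`, then
`d c₁ = d c₂` is a cycle of `Δ₁ ∩ Δ₂`. -/
theorem boundary_mem_cycles_inf {Δ₁ Δ₂ : LowerSet (Finset (Fin r))} {c : ℕ} {f c₁ c₂ : Chain k r}
    (hf : boundary k r f = 0) (h₁ : c₁ ∈ chains k Δ₁ (c + 1)) (h₂ : c₂ ∈ chains k Δ₂ (c + 1))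
    (h : f = c₁ - c₂) : boundary k r c₁ ∈ cycles k (Δ₁ ⊓ Δ₂) c := by
  have h12 : boundary k r c₁ = boundary k r c₂ := by
    rw [h, map_sub, sub_eq_zero] at hf; exact hf
  refine ⟨mem_chains_inf (boundary_mem_chains h₁) ?_, boundary_boundary _⟩
  rw [h12]
  exact boundary_mem_chains h₂

variable (k) in
/-- The cycle `d c₁` of `Δ₁ ∩ Δ₂` obtained from a cycle `f = c₁ - c₂` of `Δ ⊆ Δ₁ ∪ Δ₂`, where `c₁`
is the part of `f` carried by `Δ₁`. -/
def connectingCycle {Δ Δ₁ Δ₂ : LowerSet (Finset (Fin r))} (h : Δ ≤ Δ₁ ⊔ Δ₂) (c : ℕ) :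
    ↥(cycles k Δ (c + 1)) →ₗ[k] ↥(cycles k (Δ₁ ⊓ Δ₂) c) :=
  ((boundary k r ∘ₗ restrictTo Δ₁).domRestrict (cycles k Δ (c + 1))).codRestrict _ fun f =>
    boundary_mem_cycles_inf f.2.2 (restrictTo_mem_left h f.2.1) (restrictTo_sub_mem_right h f.2.1)
      (sub_sub_cancel _ _).symm

theorem boundary_sub_mem_boundaries {Δ₁ Δ₂ : LowerSet (Finset (Fin r))} {c : ℕ}
    {c₁ c₂ e₁ e₂ : Chain k r} (hc₁ : c₁ ∈ chains k Δ₁ (c + 1)) (hc₂ : c₂ ∈ chains k Δ₂ (c + 1))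
    (he₁ : e₁ ∈ chains k Δ₁ (c + 1)) (he₂ : e₂ ∈ chains k Δ₂ (c + 1)) (h : c₁ - c₂ = e₁ - e₂) :
    boundary k r c₁ - boundary k r e₁ ∈ boundaries k (Δ₁ ⊓ Δ₂) c := by
  refine ⟨c₁ - e₁, mem_chains_inf (Submodule.sub_mem _ hc₁ he₁) ?_, map_sub _ _ _⟩
  have : c₁ - e₁ = c₂ - e₂ := by
    rw [sub_eq_sub_iff_add_eq_add] at h ⊢
    rw [h, add_comm]
  rw [this]
  exact Submodule.sub_mem _ hc₂ he₂

theorem connectingCycle_mem {Δ Δ₁ Δ₂ : LowerSet (Finset (Fin r))} (h : Δ ≤ Δ₁ ⊔ Δ₂) (c : ℕ)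
    (f : ↥(cycles k Δ (c + 1))) (hf : (f : Chain k r) ∈ boundaries k Δ (c + 1)) :
    (connectingCycle k h c f : Chain k r) ∈ boundaries k (Δ₁ ⊓ Δ₂) c := by
  obtain ⟨g, hg, hgf⟩ := hf
  have h1 := restrictTo_mem_left h hg
  have h2 := restrictTo_sub_mem_right h hg
  have key := boundary_sub_mem_boundaries (restrictTo_mem_left h f.2.1)
    (restrictTo_sub_mem_right h f.2.1) (boundary_mem_chains h1) (boundary_mem_chains h2) (by
      rw [sub_sub_cancel, ← map_sub, sub_sub_cancel, hgf])
  rw [boundary_boundary, sub_zero] at key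
  exact key

variable (k) in
/-- The connecting k homomorphism `H̃_c(Δ) → H̃_{c-1}(Δ₁ ∩ Δ₂)` of the Mayer–Vietoris sequence, for
`Δ ⊆ Δ₁ ∪ Δ₂` (it is used for `Δ = Δ₁ ∪ Δ₂`): see `connecting_apply`. -/
def connecting {Δ Δ₁ Δ₂ : LowerSet (Finset (Fin r))} (h : Δ ≤ Δ₁ ⊔ Δ₂) (c : ℕ) :
    RedHomology k Δ (c + 1) →ₗ[k] RedHomology k (Δ₁ ⊓ Δ₂) c :=
  Submodule.mapQ _ _ (connectingCycle k h c) fun f hf => connectingCycle_mem h c f hf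

/-- `δ[f] = [d c₁]` for every way of writing `f = c₁ - c₂` with `cᵢ` a chain of `Δᵢ`. -/
theorem connecting_apply {Δ Δ₁ Δ₂ : LowerSet (Finset (Fin r))} (h : Δ ≤ Δ₁ ⊔ Δ₂) (c : ℕ)
    (f : ↥(cycles k Δ (c + 1))) {c₁ c₂ : Chain k r} (h₁ : c₁ ∈ chains k Δ₁ (c + 1))
    (h₂ : c₂ ∈ chains k Δ₂ (c + 1)) (hf : (f : Chain k r) = c₁ - c₂) :
    connecting k h c (homologyClass k Δ (c + 1) f) =
      homologyClass k (Δ₁ ⊓ Δ₂) c ⟨boundary k r c₁, boundary_mem_cycles_inf f.2.2 h₁ h₂ hf⟩ := by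
  refine (Submodule.Quotient.eq _).2 ?_
  exact boundary_sub_mem_boundaries (restrictTo_mem_left h f.2.1)
    (restrictTo_sub_mem_right h f.2.1) h₁ h₂ ((sub_sub_cancel _ _).trans hf)

/-- The complex `{∅}`. -/
abbrev emptyFace (r : ℕ) : LowerSet (Finset (Fin r)) := LowerSet.Iic ∅

variable (k) in
/-- If `∅` is a face of `Δ`, the class of the cycle `∅` in `H̃_{-1}(Δ)`. -/
def emptyClass {Δ : LowerSet (Finset (Fin r))} (h : ∅ ∈ Δ) : RedHomology k Δ 0 :=
  homologyClass k Δ 0 ⟨Pi.single ∅ 1, single_mem_chains h 1, by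
    simp [boundary_single]⟩

end Homology

/-! ### The lcm-lattice, the complexes `Δ_p`, and the Betti poset

Monomials of `S = k[x_1, …, x_n]` are written through their exponents `Fin n →₀ ℕ`: divisibility is
`≤`, the least common multiple is `⊔`, the monomial `1` is `0`, and the quotient of a monomial by a
divisor is the difference. The monomials `m_1, …, m_r` are a family `m : Fin r → Fin n →₀ ℕ`. -/

section Lattice

variable {n r : ℕ}

/-- The lcm-lattice `L_M`: the least common multiples of subsets of `{m_1, …, m_r}`. -/
def lcmLattice (m : Fin r → Fin n →₀ ℕ) : Set (Fin n →₀ ℕ) :=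
  Set.range fun A : Finset (Fin r) => A.sup m

/-- `A_p = {i | m_i divides p}`. -/
def label (m : Fin r → Fin n →₀ ℕ) (p : Fin n →₀ ℕ) : Finset (Fin r) :=
  Finset.univ.filter fun i => m i ≤ p

/-- `b` covers `a` in the poset `P`: both are in `P`, `a < b`, and nothing of `P` is in between. -/
def CoversIn (P : Set (Fin n →₀ ℕ)) (a b : Fin n →₀ ℕ) : Prop :=
  ∃ (ha : a ∈ P) (hb : b ∈ P), (⟨a, ha⟩ : P) ⋖ ⟨b, hb⟩

/-- The simplicial complex `Δ_p`, generated by the faces `A_q` for the `q` that `p` covers in the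
lcm-lattice. It is `{∅}` if `p` is an atom. -/
def Delta (m : Fin r → Fin n →₀ ℕ) (p : Fin n →₀ ℕ) : LowerSet (Finset (Fin r)) :=
  lowerClosure (label m '' {q | CoversIn (lcmLattice m) q p})

/-- The elements `p ≠ 1` of the lcm-lattice. -/
abbrev Pos (m : Fin r → Fin n →₀ ℕ) : Type :=
  {p : Fin n →₀ ℕ // p ∈ lcmLattice m ∧ p ≠ 0}

theorem lcmLattice_finite (m : Fin r → Fin n →₀ ℕ) : (lcmLattice m).Finite :=
  Set.finite_range _

instance (m : Fin r → Fin n →₀ ℕ) : Finite (Pos m) :=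
  ((lcmLattice_finite m).subset fun _ h => h.1).to_subtype

instance (m : Fin r → Fin n →₀ ℕ) : Fintype (Pos m) :=
  Fintype.ofFinite _

theorem label_mono (m : Fin r → Fin n →₀ ℕ) : Monotone (label m) := fun _ _ h _ hi => by
  simp only [label, Finset.mem_filter, Finset.mem_univ, true_and] at hi ⊢
  exact hi.trans h

theorem label_mem_Delta {m : Fin r → Fin n →₀ ℕ} {p q : Fin n →₀ ℕ} (hp : p ∈ lcmLattice m)
    (hq : q ∈ lcmLattice m) (h : q < p) : label m q ∈ Delta m p := by
  have : Finite (lcmLattice m) := (lcmLattice_finite m).to_subtype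
  obtain ⟨⟨s, hs⟩, hqs, hsp⟩ :=
    exists_le_covBy_of_lt (show (⟨q, hq⟩ : lcmLattice m) < ⟨p, hp⟩ from h)
  exact mem_lowerClosure.2 ⟨_, ⟨s, ⟨hs, hp, hsp⟩, rfl⟩, label_mono m hqs⟩

variable (k : Type u) [Field k]

/-- The Betti poset `B_M`: the elements `p` of the lcm-lattice such that `p = 1` or
`H̃(Δ_p; k) ≠ 0`. -/
def bettiPoset (m : Fin r → Fin n →₀ ℕ) : Set (Fin n →₀ ℕ) :=
  {p | p ∈ lcmLattice m ∧ (p = 0 ∨ ∃ c, Nontrivial (RedHomology k (Delta m p) c))}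

/-- The maximal elements `β_1, …, β_l` of `𝓑(p) = {q ∈ B_M | q < p}`. -/
def maxBelow (m : Fin r → Fin n →₀ ℕ) (p : Fin n →₀ ℕ) : Set (Fin n →₀ ℕ) :=
  {β | Maximal (fun q => q ∈ bettiPoset k m ∧ q < p) β}

/-- The complex `Δ̃_p` generated by `A_{β_1}, …, A_{β_l}`. -/
def DeltaTilde (m : Fin r → Fin n →₀ ℕ) (p : Fin n →₀ ℕ) : LowerSet (Finset (Fin r)) :=
  lowerClosure (label m '' maxBelow k m p)

/-- The complex generated by the faces `A_{β_j}` for the `β_j` other than `β`. -/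
def DeltaOther (m : Fin r → Fin n →₀ ℕ) (p β : Fin n →₀ ℕ) : LowerSet (Finset (Fin r)) :=
  lowerClosure (label m '' (maxBelow k m p \ {β}))

variable {k} {m : Fin r → Fin n →₀ ℕ}

theorem mem_maxBelow {p β : Fin n →₀ ℕ} :
    β ∈ maxBelow k m p ↔ Maximal (fun q => q ∈ bettiPoset k m ∧ q < p) β :=
  Iff.rfl

theorem DeltaTilde_le {p : Fin n →₀ ℕ} (hp : p ∈ lcmLattice m) :
    DeltaTilde k m p ≤ Delta m p := by
  rw [DeltaTilde, lowerClosure_le]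
  rintro _ ⟨β, hβ, rfl⟩
  rw [mem_maxBelow] at hβ
  exact label_mem_Delta hp hβ.prop.1.1 hβ.prop.2

theorem DeltaTilde_le_sup (p β : Fin n →₀ ℕ) :
    DeltaTilde k m p ≤ LowerSet.Iic (label m β) ⊔ DeltaOther k m p β := by
  rw [DeltaTilde, lowerClosure_le]
  rintro _ ⟨γ, hγ, rfl⟩
  rw [SetLike.mem_coe, LowerSet.mem_sup_iff]
  by_cases h : γ = β
  · left
    rw [h]
    exact LowerSet.mem_Iic_iff.2 le_rfl
  · right
    exact subset_lowerClosure ⟨γ, ⟨hγ, h⟩, rfl⟩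

/-- `⟨A_β⟩ ∩ ⟨A_γ | γ ≠ β⟩` is a subcomplex of `Δ_β`. -/
theorem inter_le_Delta {p β : Fin n →₀ ℕ} (hβ : β ∈ maxBelow k m p) :
    LowerSet.Iic (label m β) ⊓ DeltaOther k m p β ≤ Delta m β := by
  intro A hA
  obtain ⟨h1, h2⟩ := LowerSet.mem_inf_iff.1 hA
  rw [LowerSet.mem_Iic_iff] at h1
  obtain ⟨_, ⟨γ, ⟨hγ, hne⟩, rfl⟩, h3⟩ := mem_lowerClosure.1 h2
  rw [mem_maxBelow] at hβ hγ
  have le1 : A.sup m ≤ β := Finset.sup_le fun i hi => by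
    simpa [label] using h1 hi
  have le2 : A.sup m ≤ γ := Finset.sup_le fun i hi => by
    simpa [label] using h3 hi
  have lt1 : A.sup m < β := by
    refine lt_of_le_of_ne le1 fun h => hne ?_
    rw [h] at le2
    exact le_antisymm (hβ.le_of_ge hγ.prop le2) le2
  refine (Delta m β).lower ?_ (label_mem_Delta hβ.prop.1.1 ⟨A, rfl⟩ lt1)
  intro i hi
  simpa [label] using Finset.le_sup (f := m) hi

end Lattice

/-! ### The poset construction -/

section Construction

variable (k : Type u) [Field k] {n r : ℕ} (m : Fin r → Fin n →₀ ℕ)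

/-- `σ_p : H̃_{c-1}(Δ̃_p; k) → H̃_{c-1}(Δ_p; k)`, induced by the inclusion. -/
def sigma (p : Pos m) (c : ℕ) :
    RedHomology k (DeltaTilde k m p) c →ₗ[k] RedHomology k (Delta m p) c :=
  inclHomology k (DeltaTilde_le p.2.1) c

open Classical in
/-- The inverse of `σ_p` (`σ_p` is always bijective). -/
def sigmaInv (p : Pos m) (c : ℕ) :
    RedHomology k (Delta m p) c →ₗ[k] RedHomology k (DeltaTilde k m p) c :=
  if h : Function.Bijective (sigma k m p c) then
    (LinearEquiv.ofBijective (sigma k m p c) h).symm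
  else 0

open Classical in
/-- The map `φ_{i+2,p}^β : H̃_i(Δ_p; k) → H̃_{i-1}(Δ_β; k)`. If `β` is one of the maximal elements
`β_1, …, β_l` of `𝓑(p)`, it is the inverse of `σ_p`, followed by the Mayer–Vietoris connecting map
for `Δ̃_p = Δ₁ ∪ Δ₂`, where `Δ₁ = ⟨A_β⟩` and `Δ₂` is generated by the other `A_{β_j}`, followed by
the map induced by the inclusion of `Δ₁ ∩ Δ₂` in `Δ_β`. Otherwise it is zero. -/
def phi (p β : Pos m) (i : ℕ) :
    RedHomology k (Delta m p) (i + 1) →ₗ[k] RedHomology k (Delta m β) i :=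
  if h : (β : Fin n →₀ ℕ) ∈ maxBelow k m p then
    inclHomology k (inter_le_Delta h) i ∘ₗ
      connecting k (DeltaTilde_le_sup (p : Fin n →₀ ℕ) β) i ∘ₗ sigmaInv k m p (i + 1)
  else 0

open Classical in
/-- The component `H̃_{-1}(Δ_p; k) → H̃_{-1}({∅}; k)` of `φ_1`: the identity if `Δ_p = {∅}`, zero
otherwise (where the source is zero unless `p` is an atom). -/
def phiOne (p : Pos m) : RedHomology k (Delta m p) 0 →ₗ[k] RedHomology k (emptyFace r) 0 :=
  if h : Delta m p ≤ emptyFace r then inclHomology k h 0 else 0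

/-- `𝓓_0 = H̃_{-1}({∅}; k)`, and `𝓓_{i+1}` is the direct sum of `H̃_{i-1}(Δ_p; k)` over the
`p ≠ 1` of the lcm-lattice (written as a product, since these `p` are finite in number). -/
def DSpace : ℕ → Type u
  | 0 => RedHomology k (emptyFace r) 0
  | i + 1 => ∀ p : Pos m, RedHomology k (Delta m p) i

instance : ∀ i, AddCommGroup (DSpace k m i)
  | 0 => inferInstanceAs (AddCommGroup (RedHomology k (emptyFace r) 0))
  | i + 1 => inferInstanceAs (AddCommGroup (∀ p : Pos m, RedHomology k (Delta m p) i))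

instance : ∀ i, Module k (DSpace k m i)
  | 0 => inferInstanceAs (Module k (RedHomology k (emptyFace r) 0))
  | i + 1 => inferInstanceAs (Module k (∀ p : Pos m, RedHomology k (Delta m p) i))

/-- The inclusion of the summand `H̃_{i-1}(Δ_p; k)` in `𝓓_{i+1}`. -/
def summandIncl (p : Pos m) (i : ℕ) : RedHomology k (Delta m p) i →ₗ[k] DSpace k m (i + 1) :=
  LinearMap.single k (fun q : Pos m => RedHomology k (Delta m q) i) p

/-- The projection of `𝓓_{i+1}` to its summand `H̃_{i-1}(Δ_p; k)`. -/
def summandProj (p : Pos m) (i : ℕ) : DSpace k m (i + 1) →ₗ[k] RedHomology k (Delta m p) i :=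
  (LinearMap.proj p : (∀ q : Pos m, RedHomology k (Delta m q) i) →ₗ[k] _)

/-- The maps `φ_{i+1} : 𝓓_{i+1} → 𝓓_i`. -/
def Dmap : ∀ i, DSpace k m (i + 1) →ₗ[k] DSpace k m i
  | 0 => ∑ p : Pos m, phiOne k m p ∘ₗ summandProj k m p 0
  | i + 1 => ∑ p : Pos m, ∑ β : Pos m,
      summandIncl k m β i ∘ₗ phi k m p β i ∘ₗ summandProj k m p (i + 1)

/-- A choice of a basis of every `H̃(Δ_p; k)` and of `H̃_{-1}({∅}; k)`. In dimension `-1` the basis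
element is the class of `∅`. -/
structure HomologyBases where
  /-- The basis of `H̃_{c-1}(Δ_p; k)`. -/
  basis : ∀ (p : Pos m) (c : ℕ),
    Module.Basis (Fin (Module.finrank k (RedHomology k (Delta m p) c))) k
      (RedHomology k (Delta m p) c)
  basis_empty : ∀ (p : Pos m) (h : ∅ ∈ Delta m p) s, basis p 0 s = emptyClass k h
  /-- The basis of `H̃_{-1}({∅}; k)`. -/
  bottom : Module.Basis Unit k (RedHomology k (emptyFace r) 0)
  bottom_empty : bottom () = emptyClass k (LowerSet.mem_Iic_iff.2 le_rfl)

/-- The index sets of the bases of `𝓓_0, 𝓓_1, …`. -/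
def DIndex : ℕ → Type
  | 0 => Unit
  | i + 1 => Σ p : Pos m, Fin (Module.finrank k (RedHomology k (Delta m p) i))

/-- The basis of `𝓓_i` given by bases of the homology groups. -/
def DBasis (b : HomologyBases k m) : ∀ i, Module.Basis (DIndex k m i) k (DSpace k m i)
  | 0 => b.bottom
  | i + 1 => Pi.basis fun p => b.basis p i

end Construction

section Bases

variable {k : Type u} [Field k] {r n : ℕ}

theorem exists_smul_emptyClass {Δ : LowerSet (Finset (Fin r))} (h : ∅ ∈ Δ)
    (x : RedHomology k Δ 0) : ∃ a : k, a • emptyClass k h = x := by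
  obtain ⟨⟨f, hf⟩, rfl⟩ := Submodule.Quotient.mk_surjective _ x
  refine ⟨f ∅, ?_⟩
  have key : f = f ∅ • (Pi.single ∅ 1 : Chain k r) := by
    funext A
    by_cases hA : A = ∅
    · subst hA; simp
    · rw [hf.1 A fun h' => hA (Finset.card_eq_zero.1 h'.2)]
      simp [hA]
  refine (Submodule.Quotient.eq _).2 ?_
  have h0 : f ∅ • (⟨Pi.single ∅ 1, single_mem_chains h 1, by simp [boundary_single]⟩ :
      cycles k Δ 0) - ⟨f, hf⟩ = 0 := by
    rw [sub_eq_zero]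
    exact Subtype.ext key.symm
  have := Submodule.zero_mem ((boundaries k Δ 0).submoduleOf (cycles k Δ 0))
  rw [← h0] at this
  exact this

theorem emptyClass_ne_zero :
    emptyClass k (r := r) (Δ := emptyFace r) (LowerSet.mem_Iic_iff.2 le_rfl) ≠ 0 := by
  intro h
  obtain ⟨g, hg, hgf⟩ := (Submodule.Quotient.mk_eq_zero _).1 h
  have : g = 0 := by
    funext A
    refine hg A ?_
    rintro ⟨hA, hc⟩
    have := Finset.subset_empty.1 (LowerSet.mem_Iic_iff.1 hA)
    subst this
    simp at hc
  subst this
  have := congrFun hgf ∅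
  simp at this

theorem exists_basis {Δ : LowerSet (Finset (Fin r))} (c : ℕ) :
    ∃ b : Module.Basis (Fin (Module.finrank k (RedHomology k Δ c))) k (RedHomology k Δ c),
    ∀ (hc : c = 0) (h : ∅ ∈ Δ) s, b s = hc ▸ emptyClass k h := by
  rcases c with _ | c
  · by_cases h : ∃ h : ∅ ∈ Δ, emptyClass k h ≠ 0
    · obtain ⟨h, hne⟩ := h
      have h1 : Module.finrank k (RedHomology k Δ 0) = 1 :=
        (finrank_eq_one_iff_of_nonzero' _ hne).2 (exists_smul_emptyClass h)
      rw [h1]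
      exact ⟨FiniteDimensional.basisSingleton (Fin 1) h1 _ hne, fun hc h s => by simp⟩
    · push Not at h
      refine ⟨Module.finBasis k _, fun hc h' s => ?_⟩
      have : Subsingleton (RedHomology k Δ 0) := by
        refine ⟨fun x y => ?_⟩
        obtain ⟨a, rfl⟩ := exists_smul_emptyClass h' x
        obtain ⟨a, rfl⟩ := exists_smul_emptyClass h' y
        simp [h h']
      exact Subsingleton.elim _ _
  · exact ⟨Module.finBasis k _, fun hc => by omega⟩

/-- Such bases exist. -/
theorem nonempty_bases (m : Fin r → Fin n →₀ ℕ) : Nonempty (HomologyBases k m) := by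
  choose b hb using fun (p : Pos m) (c : ℕ) => exists_basis (k := k) (Δ := Delta m p) c
  have h1 := (finrank_eq_one_iff_of_nonzero' _ (emptyClass_ne_zero (k := k) (r := r))).2
    (exists_smul_emptyClass _)
  exact ⟨⟨b, fun p h s => hb p 0 rfl h s,
    FiniteDimensional.basisSingleton Unit h1 _ emptyClass_ne_zero, by simp⟩⟩

end Bases

/-! ### Sequences of vector spaces and frames -/

/-- A sequence `⋯ → V_1 → V_0` of `k`-vector spaces with fixed bases. -/
structure BasedSeq (k : Type u) [Field k] where
  V : ℕ → Type u
  [addCommGroup : ∀ i, AddCommGroup (V i)]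
  [module : ∀ i, Module k (V i)]
  ι : ℕ → Type
  basis : ∀ i, Module.Basis (ι i) k (V i)
  d : ∀ i, V (i + 1) →ₗ[k] V i

attribute [instance] BasedSeq.addCommGroup BasedSeq.module

/-- An `r`-frame: a finite complex `U` of finite-dimensional vector spaces with fixed bases, such
that `U_0 = k`, `U_1 = k^r`, and `U_1 → U_0` sends each basis element to the basis element. -/
structure IsFrame {k : Type u} [Field k] (r : ℕ) (U : BasedSeq k) : Prop where
  finite : ∀ i, Finite (U.ι i)
  bounded : ∃ N, ∀ i, N ≤ i → IsEmpty (U.ι i)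
  d_comp_d : ∀ i x, U.d i (U.d (i + 1) x) = 0
  card_zero : Nat.card (U.ι 0) = 1
  card_one : Nat.card (U.ι 1) = r
  d_basis : ∀ a o, U.d 0 (U.basis 1 a) = U.basis 0 o

/-- The poset construction `𝓓(L_M)`. -/
def posetConstruction (k : Type u) [Field k] {n r : ℕ} (m : Fin r → Fin n →₀ ℕ)
    (b : HomologyBases k m) : BasedSeq k where
  V := DSpace k m
  ι := DIndex k m
  basis := DBasis k m b
  d := Dmap k m

/-! ### Multigraded free modules and resolutions -/

open MvPolynomial (monomial)

/-- A sequence `⋯ → X_1 → X_0` of free `S`-modules, `S = k[x_1, …, x_n]`, with a fixed basis of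
each, whose elements are assigned multidegrees. -/
structure LabelledSeq (k : Type u) [Field k] (n : ℕ) where
  X : ℕ → Type u
  [addCommGroup : ∀ i, AddCommGroup (X i)]
  [module : ∀ i, Module (MvPolynomial (Fin n) k) (X i)]
  ι : ℕ → Type
  basis : ∀ i, Module.Basis (ι i) (MvPolynomial (Fin n) k) (X i)
  mdeg : ∀ i, ι i → Fin n →₀ ℕ
  d : ∀ i, X (i + 1) →ₗ[MvPolynomial (Fin n) k] X i

attribute [instance] LabelledSeq.addCommGroup LabelledSeq.module

section Resolution

variable {k : Type u} [Field k] {n r : ℕ}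

/-- The coefficient of the basis element `b` of `X_i` in the image of the basis element `a` of
`X_{i+1}`. -/
def LabelledSeq.entry (F : LabelledSeq k n) (i : ℕ) (a : F.ι (i + 1)) (b : F.ι i) :
    MvPolynomial (Fin n) k :=
  (F.basis i).repr (F.d i (F.basis (i + 1) a)) b

/-- A finite complex of finitely generated multigraded free `S`-modules, with multigraded
differentials: the entry at basis elements of multidegrees `p` and `q` is zero, or `q` divides `p`
and the entry is a scalar multiple of `p / q`. -/
structure LabelledSeq.IsComplex (F : LabelledSeq k n) : Prop where
  finite : ∀ i, Finite (F.ι i)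
  bounded : ∃ N, ∀ i, N ≤ i → IsEmpty (F.ι i)
  multigraded : ∀ i a b, F.entry i a b ≠ 0 → F.mdeg i b ≤ F.mdeg (i + 1) a ∧
    ∃ c : k, F.entry i a b = monomial (F.mdeg (i + 1) a - F.mdeg i b) c
  d_comp_d : ∀ i x, F.d i (F.d (i + 1) x) = 0

/-- `F` is a minimal free resolution of `S/M`: a complex of multigraded free modules, exact in
positive homological degrees, whose cokernel at `X_0` is `S/M` by a multigraded map, and such that
the image of every differential is in `(x_1, …, x_n)` times the target. -/
structure LabelledSeq.IsMinimalFreeResolution (F : LabelledSeq k n)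
    (M : Ideal (MvPolynomial (Fin n) k)) : Prop where
  isComplex : F.IsComplex
  exact : ∀ i, Function.Exact (F.d (i + 1)) (F.d i)
  augmentation : ∃ ε : F.X 0 →ₗ[MvPolynomial (Fin n) k] MvPolynomial (Fin n) k ⧸ M,
    Function.Surjective ε ∧ Function.Exact (F.d 0) ε ∧
      ∀ a, ∃ c : k, ε (F.basis 0 a) = Ideal.Quotient.mk M (monomial (F.mdeg 0 a) c)
  minimal : ∀ i x, F.d i x ∈
    Ideal.span (Set.range (MvPolynomial.X : Fin n → MvPolynomial (Fin n) k)) •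
      (⊤ : Submodule (MvPolynomial (Fin n) k) (F.X i))

/-- Equality of sequences of multigraded free modules with fixed bases: there is an isomorphism
that induces a bijection between the fixed bases which preserves multidegrees. -/
def LabelledSeq.Equal (F G : LabelledSeq k n) : Prop :=
  ∃ (φ : ∀ i, F.X i ≃ₗ[MvPolynomial (Fin n) k] G.X i) (e : ∀ i, F.ι i ≃ G.ι i),
    (∀ i x, φ i (F.d i x) = G.d i (φ (i + 1) x)) ∧
      ∀ i a, φ i (F.basis i a) = G.basis i (e i a) ∧ F.mdeg i a = G.mdeg i (e i a)

/-- The monomial ideal `M` generated by `m_1, …, m_r`. -/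
def monomialIdeal (k : Type u) [Field k] (m : Fin r → Fin n →₀ ℕ) :
    Ideal (MvPolynomial (Fin n) k) :=
  Ideal.span (Set.range fun i => monomial (m i) (1 : k))

/-- The ideal generated by `m_1, …, m_r` is Betti-linear: its quotient has a minimal free resolution
such that, whenever a basis element of multidegree `q` has a nonzero coefficient in the image of a
basis element of multidegree `p`, the element `p` covers `q` in the Betti poset. -/
def BettiLinear (k : Type u) [Field k] (m : Fin r → Fin n →₀ ℕ) : Prop :=
  ∃ F : LabelledSeq k n, F.IsMinimalFreeResolution (monomialIdeal k m) ∧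
    ∀ i a b, F.entry i a b ≠ 0 → CoversIn (bettiPoset k m) (F.mdeg i b) (F.mdeg (i + 1) a)

/-- The multidegrees in the homogenization of a frame: `1` in degree `0`, the monomials
`m_1, …, m_r` in degree `1` (`w` labels the basis of `U_1`), and then, for a basis element `v`, the
least common multiple of the multidegrees of the basis elements with a nonzero coefficient in
`d v`. -/
def homogenizationDegree (m : Fin r → Fin n →₀ ℕ) (U : BasedSeq k) (w : U.ι 1 → Fin r) :
    ∀ i, U.ι i → Fin n →₀ ℕ
  | 0 => fun _ => 0
  | 1 => fun a => m (w a)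
  | i + 2 => fun v =>
      ((U.basis (i + 1)).repr (U.d (i + 1) (U.basis (i + 2) v))).support.sup
        (homogenizationDegree m U w (i + 1))

/-- The `M`-homogenization of a frame: if `d v = ∑ α_u u` in the frame, then
`d v = ∑ α_u (mdeg v / mdeg u) u` in its homogenization. -/
def homogenization (m : Fin r → Fin n →₀ ℕ) (U : BasedSeq k) (w : U.ι 1 → Fin r) :
    LabelledSeq k n where
  X i := U.ι i →₀ MvPolynomial (Fin n) k
  ι := U.ι
  basis _ := Finsupp.basisSingleOne
  mdeg := homogenizationDegree m U w
  d i := Finsupp.linearCombination (MvPolynomial (Fin n) k) fun v =>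
    ((U.basis i).repr (U.d i (U.basis (i + 1) v))).sum fun u α =>
      Finsupp.single u (monomial
        (homogenizationDegree m U w (i + 1) v - homogenizationDegree m U w i u) α)

/-- The multidegrees in `𝓕(L_M)`: the basis element of `𝓓_0` has multidegree `1`, the basis elements
of `H̃(Δ_p; k)` have multidegree `p`. -/
def posetDegree (k : Type u) [Field k] (m : Fin r → Fin n →₀ ℕ) :
    ∀ i, DIndex k m i → Fin n →₀ ℕ
  | 0 => fun _ => 0
  | _ + 1 => fun a => a.1

/-- The maps `∂_{i+1} : 𝓓_{i+1} ⊗ S → 𝓓_i ⊗ S`: the component of `φ_{i+1}` from the summand of `p`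
to the summand of `β` is multiplied by the monomial `p / β`, where `β = 1` in degree `0`. -/
def posetDifferential (k : Type u) [Field k] (m : Fin r → Fin n →₀ ℕ) :
    ∀ i, MvPolynomial (Fin n) k ⊗[k] DSpace k m (i + 1) →ₗ[MvPolynomial (Fin n) k]
      MvPolynomial (Fin n) k ⊗[k] DSpace k m i
  | 0 => ∑ p : Pos m, monomial (p : Fin n →₀ ℕ) (1 : k) •
      (phiOne k m p ∘ₗ summandProj k m p 0 : DSpace k m 1 →ₗ[k] DSpace k m 0).baseChange _
  | i + 1 => ∑ p : Pos m, ∑ β : Pos m,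
      monomial ((p : Fin n →₀ ℕ) - (β : Fin n →₀ ℕ)) (1 : k) •
        (summandIncl k m β i ∘ₗ phi k m p β i ∘ₗ summandProj k m p (i + 1)).baseChange _

/-- The sequence `𝓕(L_M)` of multigraded free modules. -/
def posetSequence (k : Type u) [Field k] (m : Fin r → Fin n →₀ ℕ) (b : HomologyBases k m) :
    LabelledSeq k n where
  X i := MvPolynomial (Fin n) k ⊗[k] DSpace k m i
  ι := DIndex k m
  basis i := Algebra.TensorProduct.basis _ (DBasis k m b i)
  mdeg := posetDegree k m
  d := posetDifferential k m

end Resolution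

end PosetResolution

end

noncomputable section

universe u

namespace PosetResolution

/-! ### Chains of the simplex filtered by least common multiples, and their acyclicity. -/

section Chains

variable {k : Type u} [Field k] {n r : ℕ} {m : Fin r → Fin n →₀ ℕ}

/-! Let C be the complex of vector spaces obtained by setting all variables to 1 in a Betti-linear
minimal free resolution, its basis elements keeping their multidegrees. For every monomial α the
part C_{≤α} is exact in positive degrees, and exact everywhere if α lies in M; the differential D
strictly lowers multidegrees. The augmented chains of the full simplex on the generators, where a
face has the lcm of its vertices as degree, have the same exactness, being cones. So there is a
degree-preserving comparison map f from C to these chains (`exists_comparison`), and a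
Mayer–Vietoris induction shows that f restricts to a quasi-isomorphism over every lower set of
monomials (`exists_of_isLowerSet`).

The chains with lcm strictly below p are those of Δ_p; the chains with lcm dividing some β_j are
those of Δ̃_p. As the degrees of C lie in the Betti poset, the two conditions select the same part
C_{<p} of C, so σ_p is an isomorphism (`sigma_bijective`). Exactness of C_{≤p} and the strict
decrease of degrees make y ↦ [f(Dy)] an isomorphism `theta` from the part of C in multidegree p to
H̃(Δ_p).

By Betti-linearity, Dy is supported in the degrees β_j when y has degree p. Hence f(Dy) is already a
cycle of Δ̃_p, written as a sum of chains of the simplices ⟨A_{β_j}⟩, and the connecting map picks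
out d f(z) = f(Dz), with z the β-component of Dy. Thus φ corresponds to D under `theta`
(`phi_theta`, `Dmap_toDSpace`), and putting the monomials back turns this into an isomorphism of
𝓕(L_M) with the given resolution. That lcms recover the multidegrees is again exactness: if Dy were
supported below some q < p, it would be a boundary from degrees below q, forcing y = 0
(`eq_of_phi_le`). -/

theorem map_mem_of_single {E X : Type*} [Fintype E] [DecidableEq E] [AddCommGroup X] [Module k X]
    (L : (E → k) →ₗ[k] X) (N : Submodule k X) (y : E → k)
    (h : ∀ e, y e ≠ 0 → L (Pi.single e 1) ∈ N) : L y ∈ N := by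
  rw [pi_eq_sum_univ' y, map_sum]
  refine Submodule.sum_mem _ fun e _ => ?_
  rw [map_smul]
  by_cases he : y e = 0
  · rw [he, zero_smul]; exact N.zero_mem
  · exact N.smul_mem _ (h e he)

theorem subset_label_iff {A : Finset (Fin r)} {α : Fin n →₀ ℕ} :
    A ⊆ label m α ↔ A.sup m ≤ α := by
  rw [Finset.sup_le_iff]
  exact forall₂_congr fun i _ => by simp [label]

theorem sup_mem_lcmLattice (A : Finset (Fin r)) : A.sup m ∈ lcmLattice m := ⟨A, rfl⟩

/-- A face is contained in the label of its own lcm, so the facets `label m q` generate all faces of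
lcm strictly below p. This makes Δ_p a complex cut out by a lower set of monomials. -/
theorem mem_Delta_iff {p : Fin n →₀ ℕ} (hp : p ∈ lcmLattice m) {A : Finset (Fin r)} :
    A ∈ Delta m p ↔ A.sup m < p := by
  constructor
  · intro h
    obtain ⟨_, ⟨q, ⟨hq, hp', hqp⟩, rfl⟩, hA⟩ := mem_lowerClosure.1 h
    exact (subset_label_iff.1 hA).trans_lt hqp.lt
  · intro h
    exact (Delta m p).lower (subset_label_iff.2 le_rfl)
      (label_mem_Delta hp (sup_mem_lcmLattice A) h)

theorem mem_DeltaTilde_iff {p : Fin n →₀ ℕ} {A : Finset (Fin r)} :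
    A ∈ DeltaTilde k m p ↔ ∃ β ∈ maxBelow k m p, A.sup m ≤ β := by
  constructor
  · intro h
    obtain ⟨_, ⟨β, hβ, rfl⟩, hA⟩ := mem_lowerClosure.1 h
    exact ⟨β, hβ, subset_label_iff.1 hA⟩
  · rintro ⟨β, hβ, hA⟩
    exact mem_lowerClosure.2 ⟨_, ⟨β, hβ, rfl⟩, subset_label_iff.2 hA⟩

variable (k m) in
/-- The chains carried by the faces whose least common multiple is in `U`. -/
def chainsOn (U : Set (Fin n →₀ ℕ)) : Submodule k (Chain k r) where
  carrier := {x | ∀ A, A.sup m ∉ U → x A = 0}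
  zero_mem' := fun _ _ => rfl
  add_mem' := fun hx hy A hA => by rw [Pi.add_apply, hx A hA, hy A hA, add_zero]
  smul_mem' := fun a x hx A hA => by rw [Pi.smul_apply, hx A hA, smul_zero]

theorem chainsOn_mono {U W : Set (Fin n →₀ ℕ)} (h : U ⊆ W) : chainsOn k m U ≤ chainsOn k m W :=
  fun _ hx A hA => hx A fun h' => hA (h h')

theorem single_mem_chainsOn {U : Set (Fin n →₀ ℕ)} {A : Finset (Fin r)} (hA : A.sup m ∈ U)
    (a : k) : (Pi.single A a : Chain k r) ∈ chainsOn k m U := by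
  intro B hB
  have hne : B ≠ A := by
    rintro rfl
    exact hB hA
  simp [hne]

theorem boundary_mem_chainsOn {U : Set (Fin n →₀ ℕ)} (hU : IsLowerSet U) {x : Chain k r}
    (hx : x ∈ chainsOn k m U) : boundary k r x ∈ chainsOn k m U := by
  refine map_mem_of_single _ _ _ fun A hA => ?_
  rw [boundary_single]
  refine Submodule.sum_mem _ fun i _ => single_mem_chainsOn ?_ _
  refine hU (Finset.sup_mono (Finset.erase_subset i A)) ?_
  by_contra h
  exact hA (hx A h)

/-- The part of a chain carried by the faces with `c` elements. -/
def cardPart (c : ℕ) : Chain k r →ₗ[k] Chain k r where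
  toFun x A := if A.card = c then x A else 0
  map_add' x y := by funext A; simp only [Pi.add_apply]; split_ifs <;> simp
  map_smul' a x := by funext A; simp

theorem cardPart_apply (c : ℕ) (x : Chain k r) (A : Finset (Fin r)) :
    cardPart c x A = if A.card = c then x A else 0 := rfl

theorem cardPart_single (c : ℕ) (A : Finset (Fin r)) (a : k) :
    cardPart c (Pi.single A a : Chain k r) = if A.card = c then Pi.single A a else 0 := by
  funext B
  rw [cardPart_apply]
  by_cases h : B = A
  · subst h; split_ifs <;> simp
  · split_ifs <;> simp [h]

/-- Lets the arguments below use chains of mixed dimension and cut out a single dimension at the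
end. -/
theorem boundary_cardPart (c : ℕ) (x : Chain k r) :
    boundary k r (cardPart (c + 1) x) = cardPart c (boundary k r x) := by
  suffices h : boundary k r ∘ₗ cardPart (c + 1) = cardPart c ∘ₗ boundary k r from
    LinearMap.congr_fun h x
  refine LinearMap.pi_ext fun A a => ?_
  rw [LinearMap.comp_apply, LinearMap.comp_apply, boundary_single, map_sum, cardPart_single]
  have key : ∀ i ∈ A, ((A.erase i).card = c ↔ A.card = c + 1) := fun i hi => by
    rw [← Finset.card_erase_add_one hi]; omega
  split_ifs with h
  · rw [boundary_single]
    refine Finset.sum_congr rfl fun i hi => ?_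
    rw [cardPart_single, if_pos ((key i hi).2 h)]
  · rw [map_zero]
    refine (Finset.sum_eq_zero fun i hi => ?_).symm
    rw [cardPart_single, if_neg (mt (key i hi).1 h)]

theorem cardPart_mem_chainsOn {U : Set (Fin n →₀ ℕ)} (c : ℕ) {x : Chain k r}
    (hx : x ∈ chainsOn k m U) : cardPart c x ∈ chainsOn k m U := fun A hA => by
  rw [cardPart_apply, hx A hA, ite_self]

/-- Separates the support condition, which is the one shared with C, from the dimension. -/
theorem mem_chains_of_forall {Δ : LowerSet (Finset (Fin r))} {U : Set (Fin n →₀ ℕ)}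
    (hΔ : ∀ A, A ∈ Δ ↔ A.sup m ∈ U) {c : ℕ} {x : Chain k r} :
    x ∈ chains k Δ c ↔ x ∈ chainsOn k m U ∧ cardPart c x = x := by
  constructor
  · intro h
    refine ⟨fun A hA => h A fun h' => hA ((hΔ A).1 h'.1), funext fun A => ?_⟩
    rw [cardPart_apply]
    split_ifs with hA
    · rfl
    · exact (h A fun h' => hA h'.2).symm
  · rintro ⟨h1, h2⟩ A hA
    by_cases hc : A.card = c
    · exact h1 A fun h' => hA ⟨(hΔ A).2 h', hc⟩
    · rw [← h2, cardPart_apply, if_neg hc]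

theorem cardPart_cardPart (c : ℕ) (x : Chain k r) : cardPart c (cardPart c x) = cardPart c x := by
  funext A
  simp only [cardPart_apply]
  split_ifs <;> rfl

/-- The cone operator of the simplex with respect to a vertex `j`. -/
def coneOp (j : Fin r) : Chain k r →ₗ[k] Chain k r :=
  Fintype.linearCombination k fun A : Finset (Fin r) =>
    if j ∈ A then 0 else Pi.single (insert j A) 1

theorem coneOp_single (j : Fin r) (A : Finset (Fin r)) (a : k) :
    coneOp j (Pi.single A a : Chain k r) = if j ∈ A then 0 else Pi.single (insert j A) a := by
  rw [coneOp, Fintype.linearCombination_apply_single]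
  split_ifs
  · simp
  · rw [← Pi.single_smul, smul_eq_mul, mul_one]

/-- Since j precedes every vertex of A, it is removed with sign +1, while adding it flips the signs
of the other terms, which therefore cancel. -/
theorem boundary_coneOp_single {j : Fin r} {A : Finset (Fin r)} (hA : ∀ i ∈ A, j ≤ i) :
    boundary k r (coneOp j (Pi.single A 1)) + coneOp j (boundary k r (Pi.single A 1)) =
      Pi.single A 1 := by
  have hmin : A.filter (· < j) = ∅ :=
    Finset.filter_eq_empty_iff.2 fun i hi => not_lt.2 (hA i hi)
  rw [coneOp_single, boundary_single, map_sum]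
  split_ifs with hj
  · rw [map_zero, zero_add, Finset.sum_eq_single_of_mem j hj]
    · rw [coneOp_single, if_neg (Finset.notMem_erase j A), Finset.insert_erase hj, hmin]
      simp
    · intro i _ hij
      rw [coneOp_single, if_pos (Finset.mem_erase.2 ⟨hij.symm, hj⟩)]
  · rw [boundary_single, Finset.sum_insert hj, Finset.erase_insert hj, add_assoc,
      ← Finset.sum_add_distrib, Finset.sum_eq_zero, add_zero]
    · have : (insert j A).filter (· < j) = ∅ := by
        rw [Finset.filter_insert, if_neg (lt_irrefl j), hmin]
      simp [this]
    · intro i hi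
      have hji : j < i := lt_of_le_of_ne (hA i hi) fun h => hj (h ▸ hi)
      have hj' : j ∉ A.filter (· < i) := fun h => hj (Finset.mem_filter.1 h).1
      rw [coneOp_single, if_neg fun h => hj (Finset.mem_of_mem_erase h),
        Finset.erase_insert_of_ne hji.ne, ← Pi.single_add, Finset.filter_insert, if_pos hji,
        Finset.card_insert_of_notMem hj', pow_succ]
      simp

/-- The faces of lcm dividing α form the full simplex on `label m α`, a cone over its least vertex.
-/
theorem exists_boundary_eq {α : Fin n →₀ ℕ} (hα : ∃ i, m i ≤ α) {x : Chain k r}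
    (hx : x ∈ chainsOn k m (Set.Iic α)) (hd : boundary k r x = 0) :
    ∃ w ∈ chainsOn k m (Set.Iic α), boundary k r w = x := by
  have hne : (label m α).Nonempty := by
    obtain ⟨i, hi⟩ := hα
    exact ⟨i, by simpa [label] using hi⟩
  set j := (label m α).min' hne with hj
  have hjm : m j ≤ α := (Finset.mem_filter.1 ((label m α).min'_mem hne)).2
  refine ⟨coneOp j x, ?_, ?_⟩
  · refine map_mem_of_single _ _ _ fun A hA => ?_
    rw [coneOp_single]
    split_ifs
    · exact Submodule.zero_mem _
    · refine single_mem_chainsOn ?_ _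
      rw [Finset.sup_insert]
      refine sup_le hjm ?_
      by_contra h
      exact hA (hx A h)
  -- With ⊥ as target submodule, `map_mem_of_single` reduces an identity of linear maps to the faces
  -- in the support of x, where j is a lower bound. The same device recurs below.
  · have key : (boundary k r ∘ₗ coneOp j + coneOp j ∘ₗ boundary k r - LinearMap.id :
        Chain k r →ₗ[k] Chain k r) x ∈
        (⊥ : Submodule k (Chain k r)) := by
      refine map_mem_of_single _ _ _ fun A hA => ?_
      rw [Submodule.mem_bot, LinearMap.sub_apply, LinearMap.add_apply, LinearMap.comp_apply,
        LinearMap.comp_apply, LinearMap.id_apply, sub_eq_zero]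
      refine boundary_coneOp_single fun i hi => Finset.min'_le _ _ ?_
      have hA' : A.sup m ≤ α := by
        by_contra h
        exact hA (hx A h)
      exact subset_label_iff.2 hA' hi
    rw [Submodule.mem_bot, LinearMap.sub_apply, LinearMap.add_apply, LinearMap.comp_apply,
      LinearMap.comp_apply, LinearMap.id_apply, hd, map_zero, add_zero, sub_eq_zero] at key
    exact key

end Chains


/-! ### The dehomogenized resolution as an abstract filtered complex. -/

/-- The dehomogenization of a resolution: a complex of `k`-vector spaces with a finite basis `E`
(all homological degrees taken together), each basis element having a multidegree `deg` and a
homological degree `dim`, such that the basis elements in a differential are covered in the Betti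
poset, and such that the part in multidegrees dividing a monomial `α` is exact in positive
homological degrees, and everywhere if `α` is in the monomial ideal. -/
structure BettiComplex (k : Type u) [Field k] {n r : ℕ} (m : Fin r → Fin n →₀ ℕ) where
  E : Type
  [fintype : Fintype E]
  [decidableEq : DecidableEq E]
  deg : E → Fin n →₀ ℕ
  dim : E → ℕ
  D : (E → k) →ₗ[k] (E → k)
  bot : E
  D_D : ∀ y, D (D y) = 0
  dim_eq : ∀ e e', D (Pi.single e 1) e' ≠ 0 → dim e = dim e' + 1
  covers : ∀ e e', D (Pi.single e 1) e' ≠ 0 → CoversIn (bettiPoset k m) (deg e') (deg e)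
  dim_eq_zero : ∀ e, dim e = 0 ↔ e = bot
  deg_bot : deg bot = 0
  deg_mem : ∀ e, dim e ≠ 0 → deg e ∈ bettiPoset k m ∧ deg e ≠ 0
  exact : ∀ (α : Fin n →₀ ℕ) (y : E → k), (∀ e, deg e ∉ Set.Iic α → y e = 0) → D y = 0 →
    (y bot = 0 ∨ ∃ i, m i ≤ α) → ∃ z, (∀ e, deg e ∉ Set.Iic α → z e = 0) ∧ D z = y

attribute [instance] BettiComplex.fintype BettiComplex.decidableEq

namespace BettiComplex

variable {k : Type u} [Field k] {n r : ℕ} {m : Fin r → Fin n →₀ ℕ} (C : BettiComplex k m)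

/-- The elements carried by the basis elements with multidegree in `U`. -/
def supp (U : Set (Fin n →₀ ℕ)) : Submodule k (C.E → k) where
  carrier := {y | ∀ e, C.deg e ∉ U → y e = 0}
  zero_mem' := fun _ _ => rfl
  add_mem' := fun hx hy A hA => by rw [Pi.add_apply, hx A hA, hy A hA, add_zero]
  smul_mem' := fun a x hx A hA => by rw [Pi.smul_apply, hx A hA, smul_zero]

variable {C}

theorem dim_bot : C.dim C.bot = 0 := (C.dim_eq_zero _).2 rfl

theorem deg_mem_lcmLattice (e : C.E) : C.deg e ∈ lcmLattice m := by
  by_cases h : C.dim e = 0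
  · rw [(C.dim_eq_zero e).1 h, C.deg_bot]
    exact ⟨∅, Finset.sup_empty⟩
  · exact (C.deg_mem e h).1.1

theorem deg_mem_bettiPoset (e : C.E) : C.deg e ∈ bettiPoset k m := by
  by_cases h : C.dim e = 0
  · refine ⟨deg_mem_lcmLattice e, Or.inl ?_⟩
    rw [(C.dim_eq_zero e).1 h, C.deg_bot]
  · exact (C.deg_mem e h).1

theorem exists_le_of_mem {p : Fin n →₀ ℕ} (hp : p ∈ lcmLattice m) (h0 : p ≠ 0) :
    ∃ i, m i ≤ p := by
  obtain ⟨A, rfl⟩ := hp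
  by_contra! h
  have : A = ∅ := Finset.eq_empty_of_forall_notMem fun i hi => h i (Finset.le_sup hi)
  subst this
  exact h0 rfl

theorem exists_le_deg {e : C.E} (he : e ≠ C.bot) : ∃ i, m i ≤ C.deg e := by
  have h := C.deg_mem e (mt (C.dim_eq_zero e).1 he)
  exact exists_le_of_mem h.1.1 h.2

theorem deg_lt {e e' : C.E} (h : C.D (Pi.single e 1) e' ≠ 0) : C.deg e' < C.deg e := by
  obtain ⟨_, _, h'⟩ := C.covers e e' h
  exact h'.lt

theorem D_bot : C.D (Pi.single C.bot 1) = 0 := by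
  funext e
  by_contra h
  have := C.dim_eq _ _ h
  rw [dim_bot] at this
  omega

theorem single_mem_supp {U : Set (Fin n →₀ ℕ)} {e : C.E} (he : C.deg e ∈ U) (a : k) :
    (Pi.single e a : C.E → k) ∈ C.supp U := by
  intro e' he'
  have hne : e' ≠ e := by
    rintro rfl
    exact he' he
  simp [hne]

theorem supp_mono {U W : Set (Fin n →₀ ℕ)} (h : U ⊆ W) : C.supp U ≤ C.supp W :=
  fun _ hx A hA => hx A fun h' => hA (h h')

theorem D_mem_supp {U : Set (Fin n →₀ ℕ)} (hU : IsLowerSet U) {y : C.E → k}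
    (hy : y ∈ C.supp U) : C.D y ∈ C.supp U := by
  refine map_mem_of_single _ _ _ fun e he e' he' => ?_
  by_contra h
  refine he (hy e fun h' => he' (hU (deg_lt h).le h'))

/-! ### The comparison map to the simplex. -/

variable (C) in
/-- A comparison map to the chains of the full simplex. -/
structure IsComparison (f : (C.E → k) →ₗ[k] Chain k r) : Prop where
  mem : ∀ e, f (Pi.single e 1) ∈ chainsOn k m (Set.Iic (C.deg e))
  card : ∀ e, cardPart (C.dim e) (f (Pi.single e 1)) = f (Pi.single e 1)
  comm : ∀ y, boundary k r (f y) = f (C.D y)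
  bot : f (Pi.single C.bot 1) = Pi.single ∅ 1

/-- The usual lifting by induction on homological degree: f(De) is a cycle on faces of lcm dividing
deg e, hence bounds there, and a bounding chain serves as f(e). -/
theorem exists_comparison_aux (N : ℕ) : ∃ f : (C.E → k) →ₗ[k] Chain k r,
    (∀ e, C.dim e ≤ N → f (Pi.single e 1) ∈ chainsOn k m (Set.Iic (C.deg e)) ∧
      cardPart (C.dim e) (f (Pi.single e 1)) = f (Pi.single e 1) ∧
      boundary k r (f (Pi.single e 1)) = f (C.D (Pi.single e 1))) ∧
    f (Pi.single C.bot 1) = Pi.single ∅ 1 := by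
  induction N with
  | zero =>
    -- Only the value at `bot` matters at this stage; the others are overwritten later.
    refine ⟨Fintype.linearCombination k fun _ => Pi.single ∅ 1, fun e he => ?_, ?_⟩
    · obtain rfl := (C.dim_eq_zero e).1 (Nat.le_zero.1 he)
      rw [Fintype.linearCombination_apply_single, one_smul, D_bot, dim_bot]
      refine ⟨single_mem_chainsOn (by simp) _, ?_, ?_⟩
      · rw [cardPart_single, if_pos (by simp)]
      · rw [boundary_single]; simp
    · rw [Fintype.linearCombination_apply_single, one_smul]
  | succ N ih =>
    obtain ⟨f, hf, hbot⟩ := ih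
    have key : ∀ e, ∃ w : Chain k r, C.dim e = N + 1 →
        w ∈ chainsOn k m (Set.Iic (C.deg e)) ∧ cardPart (N + 1) w = w ∧
        boundary k r w = f (C.D (Pi.single e 1)) := by
      intro e
      by_cases he : C.dim e = N + 1
      swap
      · exact ⟨0, fun h => absurd h he⟩
      have hd : ∀ e', C.D (Pi.single e 1) e' ≠ 0 → C.dim e' = N := fun e' h' => by
        have := C.dim_eq _ _ h'
        omega
      have h1 : f (C.D (Pi.single e 1)) ∈ chainsOn k m (Set.Iic (C.deg e)) :=
        map_mem_of_single _ _ _ fun e' h' =>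
          chainsOn_mono (Set.Iic_subset_Iic.2 (deg_lt h').le) (hf e' (hd e' h').le).1
      have h2 : f (C.D (Pi.single e 1)) ∈
          LinearMap.eqLocus (cardPart N : Chain k r →ₗ[k] Chain k r) LinearMap.id :=
        map_mem_of_single _ _ _ fun e' h' => by
          have := (hf e' (hd e' h').le).2.1
          rw [hd e' h'] at this
          exact this
      have h3 : (boundary k r ∘ₗ f - f ∘ₗ C.D : (C.E → k) →ₗ[k] Chain k r)
          (C.D (Pi.single e 1)) ∈ (⊥ : Submodule k (Chain k r)) :=
        map_mem_of_single _ _ _ fun e' h' => by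
          rw [Submodule.mem_bot, LinearMap.sub_apply, sub_eq_zero]
          exact (hf e' (hd e' h').le).2.2
      rw [Submodule.mem_bot, LinearMap.sub_apply, LinearMap.comp_apply, LinearMap.comp_apply,
        C.D_D, map_zero, sub_zero] at h3
      -- Positive homological degree excludes `bot`, so some generator divides deg e and the simplex
      -- there is nonempty.
      obtain ⟨w, hw, hwd⟩ := exists_boundary_eq
        (exists_le_deg fun h => by rw [h, dim_bot] at he; omega) h1 h3
      refine ⟨cardPart (N + 1) w, fun _ => ⟨cardPart_mem_chainsOn _ hw, cardPart_cardPart _ _, ?_⟩⟩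
      rw [boundary_cardPart, hwd]
      exact h2
    choose w hw using key
    set g : (C.E → k) →ₗ[k] Chain k r := Fintype.linearCombination k fun e =>
      if C.dim e = N + 1 then w e else f (Pi.single e 1) with hg
    have hgs : ∀ e, g (Pi.single e 1) = if C.dim e = N + 1 then w e else f (Pi.single e 1) :=
      fun e => by rw [hg, Fintype.linearCombination_apply_single, one_smul]
    -- D e involves only elements of homological degree at most N, where g and f agree.
    have hgf : ∀ e, C.dim e ≤ N + 1 → g (C.D (Pi.single e 1)) = f (C.D (Pi.single e 1)) := by
      intro e he
      have : (g - f) (C.D (Pi.single e 1)) ∈ (⊥ : Submodule k (Chain k r)) :=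
        map_mem_of_single _ _ _ fun e' h' => by
          have := C.dim_eq _ _ h'
          rw [Submodule.mem_bot, LinearMap.sub_apply, hgs, if_neg (by omega), sub_self]
      rwa [Submodule.mem_bot, LinearMap.sub_apply, sub_eq_zero] at this
    refine ⟨g, fun e he => ?_, ?_⟩
    · rw [hgf e he, hgs]
      split_ifs with h
      · rw [h]; exact hw e h
      · exact hf e (by omega)
    · rw [hgs, dim_bot, if_neg (by omega), hbot]

variable (C) in
theorem exists_comparison : ∃ f, C.IsComparison f := by
  obtain ⟨f, hf, hbot⟩ := exists_comparison_aux (C := C) (Finset.univ.sup C.dim)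
  have hf' := fun e => hf e (Finset.le_sup (Finset.mem_univ e))
  refine ⟨f, fun e => (hf' e).1, fun e => (hf' e).2.1, fun y => ?_, hbot⟩
  have : (boundary k r ∘ₗ f - f ∘ₗ C.D : (C.E → k) →ₗ[k] Chain k r) y ∈
      (⊥ : Submodule k (Chain k r)) :=
    map_mem_of_single _ _ _ fun e _ => by
      rw [Submodule.mem_bot, LinearMap.sub_apply, sub_eq_zero]
      exact (hf' e).2.2
  rwa [Submodule.mem_bot, LinearMap.sub_apply, sub_eq_zero] at this

/-! ### The comparison map is a quasi-isomorphism over every lower set. -/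

namespace IsComparison

variable {f : (C.E → k) →ₗ[k] Chain k r} (hf : C.IsComparison f)
include hf

theorem map_mem {U : Set (Fin n →₀ ℕ)} (hU : IsLowerSet U) {y : C.E → k} (hy : y ∈ C.supp U) :
    f y ∈ chainsOn k m U :=
  map_mem_of_single _ _ _ fun e he => chainsOn_mono
    (fun _ hq => hU hq (by by_contra h; exact he (hy e h))) (hf.mem e)

/-- This is acyclicity of the mapping cone of f: the pair (y, x) with Dy = 0 and f y = d x is a cone
cycle, and the conclusion exhibits it as a cone boundary. It packs injectivity and surjectivity on
homology into one statement. If a generator divides α, source and target are both exact. -/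
theorem exists_of_Iic (α : Fin n →₀ ℕ) {y : C.E → k} {x : Chain k r}
    (hy : y ∈ C.supp (Set.Iic α)) (hx : x ∈ chainsOn k m (Set.Iic α)) (hD : C.D y = 0)
    (h : f y = boundary k r x) : ∃ y' ∈ C.supp (Set.Iic α), ∃ x' ∈ chainsOn k m (Set.Iic α),
      C.D y' = y ∧ x = f y' + boundary k r x' := by
  by_cases hα : ∃ i, m i ≤ α
  · obtain ⟨y', hy', rfl⟩ := C.exact α y hy hD (Or.inr hα)
    obtain ⟨x', hx', h'⟩ := exists_boundary_eq (x := x - f y') hα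
      (Submodule.sub_mem _ hx (hf.map_mem (isLowerSet_Iic α) hy'))
      (by rw [map_sub, hf.comm, h, sub_self])
    exact ⟨y', hy', x', hx', rfl, by rw [h']; abel⟩
  -- No generator divides α: only `bot` and the empty face survive, and f matches them.
  · have hy0 : y = y C.bot • (Pi.single C.bot 1 : C.E → k) := by
      funext e
      by_cases he : e = C.bot
      · subst he; simp
      · rw [hy e fun h => hα ((exists_le_deg he).imp fun i hi => hi.trans h)]
        simp [he]
    have hx0 : x = x ∅ • (Pi.single ∅ 1 : Chain k r) := by
      funext A
      by_cases hA : A = ∅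
      · subst hA; simp
      · obtain ⟨i, hi⟩ := Finset.nonempty_iff_ne_empty.2 hA
        rw [hx A fun h => hα ⟨i, (Finset.le_sup hi).trans h⟩]
        simp [hA]
    have hb : boundary k r (Pi.single ∅ 1) = 0 := by rw [boundary_single]; simp
    refine ⟨x ∅ • Pi.single C.bot 1, Submodule.smul_mem _ _ (single_mem_supp
      (by rw [C.deg_bot]; exact Set.mem_Iic.2 (zero_le (a := α))) _), 0, Submodule.zero_mem _, ?_, ?_⟩
    · rw [map_smul, D_bot, smul_zero]
      rw [hx0, map_smul, hb, smul_zero, hy0, map_smul, hf.bot] at h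
      have := congrFun h ∅
      rw [hy0]
      have h0 : y C.bot = 0 := by simpa using this
      rw [h0, zero_smul]
    · rw [map_smul, hf.bot, map_zero, add_zero]
      exact hx0

/-- Mayer–Vietoris for the cone of f. With α maximal in U ∩ L_M, the lattice points of U are covered
by the principal lower set of α and the elements U' of U not above α. Principal sets are settled; U'
and the intersection W have fewer lattice points. -/
theorem exists_of_isLowerSet {U : Set (Fin n →₀ ℕ)} (hU : IsLowerSet U) {y : C.E → k}
    {x : Chain k r} (hy : y ∈ C.supp U) (hx : x ∈ chainsOn k m U) (hD : C.D y = 0)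
    (h : f y = boundary k r x) : ∃ y' ∈ C.supp U, ∃ x' ∈ chainsOn k m U,
      C.D y' = y ∧ x = f y' + boundary k r x' := by
  classical
  induction hN : (U ∩ lcmLattice m).ncard using Nat.strong_induction_on generalizing U y x with
  | _ N ih =>
  subst hN
  have hfin : ∀ U, (U ∩ lcmLattice m).Finite := fun U =>
    (lcmLattice_finite m).subset Set.inter_subset_right
  rcases (U ∩ lcmLattice m).eq_empty_or_nonempty with he | hne
  · have hn : ∀ q ∈ lcmLattice m, q ∉ U := fun q hq hqU => by
      have : q ∈ U ∩ lcmLattice m := ⟨hqU, hq⟩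
      rw [he] at this
      exact this
    refine ⟨0, Submodule.zero_mem _, 0, Submodule.zero_mem _, ?_, ?_⟩
    · rw [map_zero]
      funext e
      exact (hy e (hn _ (deg_mem_lcmLattice e))).symm
    · rw [map_zero, map_zero, add_zero]
      funext A
      exact hx A (hn _ (sup_mem_lcmLattice A))
  obtain ⟨α, hα⟩ := (hfin U).exists_maximal hne
  set U' : Set (Fin n →₀ ℕ) := {q ∈ U | ¬ α ≤ q} with hU'
  have hU'l : IsLowerSet U' := fun a b hba ha => ⟨hU hba ha.1, fun h => ha.2 (h.trans hba)⟩
  have hlt : ∀ W ⊆ U', (W ∩ lcmLattice m).ncard < (U ∩ lcmLattice m).ncard := fun W hW => by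
    refine Set.ncard_lt_ncard ⟨fun q hq => ⟨(hW hq.1).1, hq.2⟩, fun h => ?_⟩ (hfin U)
    exact (hW (h hα.prop).1).2 le_rfl
  -- By maximality of α, a lattice point of U not dividing α is not above α, so it lies in U'.
  have hsplit : ∀ q ∈ lcmLattice m, q ∉ U' → ¬ q ≤ α → q ∉ U := fun q hq hqU' hqα hqU =>
    hqU' ⟨hqU, fun h => hqα (hα.le_of_ge ⟨hqU, hq⟩ h)⟩
  have hIl := isLowerSet_Iic α
  set W := Set.Iic α ∩ U' with hW
  have hWl : IsLowerSet W := hIl.inter hU'l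
  set ya : C.E → k := fun e => if C.deg e ≤ α then y e else 0 with hya
  set xa : Chain k r := fun A => if A.sup m ≤ α then x A else 0 with hxa
  have hya1 : ya ∈ C.supp (Set.Iic α) := fun e he => if_neg he
  have hxa1 : xa ∈ chainsOn k m (Set.Iic α) := fun e he => if_neg he
  have hyr : y - ya ∈ C.supp U' := fun e he => by
    rw [Pi.sub_apply, hya]
    dsimp only
    split_ifs with h1
    · exact sub_self _
    · rw [hy e (hsplit _ (deg_mem_lcmLattice e) he h1), sub_zero]
  have hxr : x - xa ∈ chainsOn k m U' := fun e he => by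
    rw [Pi.sub_apply, hxa]
    dsimp only
    split_ifs with h1
    · exact sub_self _
    · rw [hx e (hsplit _ (sup_mem_lcmLattice e) he h1), sub_zero]
  -- As (y, x) is a cone cycle, the boundary of its part over α is minus the boundary of the rest;
  -- being supported on both sides, it lives on W. The same holds for the second coordinate.
  have ha : C.D ya ∈ C.supp W := by
    have h1 := D_mem_supp hIl hya1
    have h2 := Submodule.neg_mem _ (D_mem_supp hU'l hyr)
    rw [map_sub, hD, zero_sub, neg_neg] at h2
    intro e he
    by_cases h' : C.deg e ∈ Set.Iic α
    · exact h2 e fun h'' => he ⟨h', h''⟩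
    · exact h1 e h'
  have hb : f ya - boundary k r xa ∈ chainsOn k m W := by
    have h1 := Submodule.sub_mem _ (hf.map_mem hIl hya1) (boundary_mem_chainsOn hIl hxa1)
    have h2 := Submodule.sub_mem _ (boundary_mem_chainsOn hU'l hxr) (hf.map_mem hU'l hyr)
    rw [map_sub, map_sub, h, sub_sub_sub_cancel_left] at h2
    intro e he
    by_cases h' : e.sup m ∈ Set.Iic α
    · exact h2 e fun h'' => he ⟨h', h''⟩
    · exact h1 e h'
  -- That boundary is bounded on W by y1 and x1. Moving them from the part over α to the rest makes
  -- both parts cone cycles, each of which is then a cone boundary.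
  obtain ⟨y1, hy1, x1, hx1, e1, e1'⟩ := ih _ (hlt W Set.inter_subset_right) hWl ha hb (C.D_D _)
    (by rw [map_sub, boundary_boundary, sub_zero, hf.comm]) rfl
  obtain ⟨y2, hy2, x2, hx2, e2, e2'⟩ := hf.exists_of_Iic α (y := ya - y1) (x := xa + x1)
    (Submodule.sub_mem _ hya1 (supp_mono Set.inter_subset_left hy1))
    (Submodule.add_mem _ hxa1 (chainsOn_mono Set.inter_subset_left hx1))
    (by rw [map_sub, e1, sub_self])
    (by rw [map_sub, map_add, sub_eq_iff_eq_add, add_assoc, add_comm (boundary k r x1), ← e1',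
      add_sub_cancel])
  obtain ⟨y3, hy3, x3, hx3, e3, e3'⟩ := ih _ (hlt U' subset_rfl) hU'l (y := y - ya + y1)
    (x := x - xa - x1)
    (Submodule.add_mem _ hyr (supp_mono Set.inter_subset_right hy1))
    (Submodule.sub_mem _ hxr (chainsOn_mono Set.inter_subset_right hx1))
    (by rw [map_add, map_sub, e1, hD]; abel)
    (by
      have : f y1 = f ya - boundary k r xa - boundary k r x1 := by rw [e1']; abel
      rw [map_add, map_sub, map_sub, map_sub, h, this]; abel) rfl
  have hIU : Set.Iic α ⊆ U := fun q hq => hU hq hα.prop.1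
  have hUU : U' ⊆ U := fun q hq => hq.1
  refine ⟨y2 + y3, Submodule.add_mem _ (supp_mono hIU hy2) (supp_mono hUU hy3), x2 + x3,
    Submodule.add_mem _ (chainsOn_mono hIU hx2) (chainsOn_mono hUU hx3), ?_, ?_⟩
  · rw [map_add, e2, e3]; abel
  · have : x = (xa + x1) + (x - xa - x1) := by abel
    rw [this, e2', e3', map_add, map_add]; abel

end IsComparison

end BettiComplex


/-! ### Representatives of reduced homology classes. -/

section ReducedHomology

variable {k : Type u} [Field k] {r : ℕ}

theorem homologyClass_eq_iff {Δ : LowerSet (Finset (Fin r))} {c : ℕ} {x y : ↥(cycles k Δ c)} :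
    homologyClass k Δ c x = homologyClass k Δ c y ↔
      ∃ w ∈ chains k Δ (c + 1), boundary k r w = x - y :=
  (Submodule.Quotient.eq _).trans Iff.rfl

theorem homologyClass_surjective (Δ : LowerSet (Finset (Fin r))) (c : ℕ) :
    Function.Surjective (homologyClass k Δ c) :=
  Submodule.mkQ_surjective _

theorem inclHomology_homologyClass {Δ Δ' : LowerSet (Finset (Fin r))} (h : Δ ≤ Δ') (c : ℕ)
    (x : ↥(cycles k Δ c)) : inclHomology k h c (homologyClass k Δ c x) =
      homologyClass k Δ' c ⟨x, cycles_mono h c x.2⟩ := rfl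

/-- Degree 0 is separate because `boundary_cardPart` starts one higher; there only the empty face
occurs. -/
theorem boundary_cardPart_eq_zero (c : ℕ) {x : Chain k r} (hx : boundary k r x = 0) :
    boundary k r (cardPart c x) = 0 := by
  rcases c with _ | c
  · refine (Submodule.mem_bot k).1 (map_mem_of_single (boundary k r) _ _ fun A hA => ?_)
    have : A = ∅ := by
      by_contra h
      refine hA ?_
      rw [cardPart_apply, if_neg fun h' => h (Finset.card_eq_zero.1 h')]
    subst this
    rw [Submodule.mem_bot, boundary_single]
    simp
  · rw [boundary_cardPart, hx, map_zero]

/-- The empty face is the boundary of any vertex. -/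
theorem redHomology_zero_eq_zero {Δ : LowerSet (Finset (Fin r))} {i : Fin r} (hi : {i} ∈ Δ)
    (x : RedHomology k Δ 0) : x = 0 := by
  have h0 : ∅ ∈ Δ := Δ.lower (Finset.empty_subset _) hi
  obtain ⟨a, rfl⟩ := exists_smul_emptyClass h0 x
  have : emptyClass k h0 = 0 := by
    refine (homologyClass_eq_iff (y := 0)).2 ⟨Pi.single {i} 1, single_mem_chains hi 1, ?_⟩
    rw [boundary_single]
    simp [Finset.filter_singleton]
  rw [this, smul_zero]

end ReducedHomology

/-! ### Multigraded pieces of C, the maps σ, and the translation of φ into D. -/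

namespace BettiComplex

variable {k : Type u} [Field k] {n r : ℕ} {m : Fin r → Fin n →₀ ℕ} {C : BettiComplex k m}

variable (k m) in
/-- The multidegrees that divide one of the maximal elements of the Betti poset below `p`. -/
def belowMax (p : Fin n →₀ ℕ) : Set (Fin n →₀ ℕ) := {q | ∃ β ∈ maxBelow k m p, q ≤ β}

theorem isLowerSet_belowMax (p : Fin n →₀ ℕ) : IsLowerSet (belowMax k m p) :=
  fun _ _ hba ⟨β, hβ, h⟩ => ⟨β, hβ, hba.trans h⟩

theorem belowMax_subset (p : Fin n →₀ ℕ) : belowMax k m p ⊆ Set.Iio p :=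
  fun _ ⟨_, hβ, h⟩ => h.trans_lt (mem_maxBelow.1 hβ).prop.2

theorem mem_maxBelow_of_coversIn {p q : Fin n →₀ ℕ} (h : CoversIn (bettiPoset k m) q p) :
    q ∈ maxBelow k m p := by
  obtain ⟨hq, hp, hqp⟩ := h
  refine PosetResolution.mem_maxBelow.2 ⟨⟨hq, hqp.lt⟩, fun s hs hqs => ?_⟩
  by_contra hsq
  exact hqp.2 (c := ⟨s, hs.1⟩) (lt_of_le_not_ge hqs hsq) hs.2

/-- The degrees of C lie in the Betti poset, where everything below p is below a maximal such
element. This is why Δ_p may be replaced by Δ̃_p. -/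
theorem supp_Iio_le (p : Fin n →₀ ℕ) : C.supp (Set.Iio p) ≤ C.supp (belowMax k m p) := by
  intro y hy e he
  refine hy e fun h => he ?_
  have hfin : {q | q ∈ bettiPoset k m ∧ q < p}.Finite :=
    (lcmLattice_finite m).subset fun q hq => hq.1.1
  obtain ⟨β, hβ, hmax⟩ := hfin.exists_le_maximal (a := C.deg e) ⟨deg_mem_bettiPoset e, h⟩
  exact ⟨β, hmax, hβ⟩

variable (C) in
/-- The part of an element in homological degree `c`. -/
def dimPart (c : ℕ) : (C.E → k) →ₗ[k] (C.E → k) where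
  toFun y e := if C.dim e = c then y e else 0
  map_add' x y := by funext A; simp only [Pi.add_apply]; split_ifs <;> simp
  map_smul' a x := by funext A; simp

variable (C) in
open Classical in
/-- The part of an element in multidegree `p` and homological degree `c`. -/
def piece (p : Fin n →₀ ℕ) (c : ℕ) : (C.E → k) →ₗ[k] (C.E → k) where
  toFun y e := if C.deg e = p ∧ C.dim e = c then y e else 0
  map_add' x y := by funext A; simp only [Pi.add_apply]; split_ifs <;> simp
  map_smul' a x := by funext A; simp

theorem dimPart_apply (c : ℕ) (y : C.E → k) (e : C.E) :
    C.dimPart c y e = if C.dim e = c then y e else 0 := rfl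

theorem piece_apply (p : Fin n →₀ ℕ) (c : ℕ) (y : C.E → k) (e : C.E)
    [Decidable (C.deg e = p ∧ C.dim e = c)] :
    C.piece p c y e = if C.deg e = p ∧ C.dim e = c then y e else 0 := by
  simp only [piece, LinearMap.coe_mk, AddHom.coe_mk]
  congr

theorem piece_dimPart (p : Fin n →₀ ℕ) (c : ℕ) (y : C.E → k) :
    C.piece p c (C.dimPart c y) = C.piece p c y := by
  classical
  funext e
  rw [piece_apply, piece_apply, dimPart_apply]
  split_ifs with h1 h2
  · rfl
  · exact absurd h1.2 h2
  · rfl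

theorem dimPart_piece (p : Fin n →₀ ℕ) (c : ℕ) (y : C.E → k) :
    C.dimPart c (C.piece p c y) = C.piece p c y := by
  classical
  funext e
  rw [dimPart_apply, piece_apply]
  split_ifs with h1 h2 h2
  · rfl
  · rfl
  · exact absurd h2.2 h1
  · rfl

theorem piece_piece (p : Fin n →₀ ℕ) (c : ℕ) (y : C.E → k) :
    C.piece p c (C.piece p c y) = C.piece p c y := by
  classical
  funext e
  simp only [piece_apply]
  split_ifs <;> rfl

theorem piece_mem_supp (p : Fin n →₀ ℕ) (c : ℕ) (y : C.E → k) : C.piece p c y ∈ C.supp {p} := by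
  classical
  intro e he
  rw [piece_apply, if_neg fun h => he h.1]

theorem dimPart_single (c : ℕ) (e : C.E) (a : k) :
    C.dimPart c (Pi.single e a) = if C.dim e = c then Pi.single e a else 0 := by
  funext e'
  rw [dimPart_apply]
  by_cases h : e' = e
  · subst h; split_ifs <;> simp
  · split_ifs <;> simp [h]

theorem D_dimPart (c : ℕ) (y : C.E → k) : C.D (C.dimPart (c + 1) y) = C.dimPart c (C.D y) := by
  have : (C.D ∘ₗ C.dimPart (c + 1) - C.dimPart c ∘ₗ C.D : (C.E → k) →ₗ[k] (C.E → k)) y ∈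
      (⊥ : Submodule k (C.E → k)) := by
    refine map_mem_of_single _ _ _ fun e _ => ?_
    rw [Submodule.mem_bot, LinearMap.sub_apply, LinearMap.comp_apply, LinearMap.comp_apply,
      sub_eq_zero, dimPart_single]
    funext e'
    rw [dimPart_apply]
    by_cases h' : C.D (Pi.single e 1) e' = 0
    · split_ifs <;> simp [h']
    · have := C.dim_eq _ _ h'
      by_cases hc : C.dim e = c + 1
      · rw [if_pos hc, if_pos (by omega)]
      · rw [if_neg hc, if_neg (by omega), map_zero, Pi.zero_apply]
  rwa [Submodule.mem_bot, LinearMap.sub_apply, sub_eq_zero] at this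

/-- The basis elements that occur in a differential. -/
theorem exists_of_D_ne_zero {y : C.E → k} {e' : C.E} (h : C.D y e' ≠ 0) :
    ∃ e, y e ≠ 0 ∧ C.D (Pi.single e 1) e' ≠ 0 := by
  by_contra! h'
  refine h ?_
  have : (LinearMap.proj e' ∘ₗ C.D : (C.E → k) →ₗ[k] k) y ∈ (⊥ : Submodule k k) :=
    map_mem_of_single _ _ _ fun e he => h' e he
  exact this

theorem D_mem_supp_Iio {p : Fin n →₀ ℕ} {y : C.E → k} (hy : y ∈ C.supp (Set.Iic p)) :
    C.D y ∈ C.supp (Set.Iio p) := by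
  intro e' he'
  by_contra h
  obtain ⟨e, he, h'⟩ := exists_of_D_ne_zero h
  have : C.deg e ≤ p := by
    by_contra h''
    exact he (hy e h'')
  exact he' ((deg_lt h').trans_le this)

/-- Here Betti-linearity enters in full, beyond the mere decrease of degrees: the differential from
degree p reaches only the β_j. -/
theorem deg_mem_maxBelow {p : Fin n →₀ ℕ} {y : C.E → k} (hy : y ∈ C.supp {p}) {e' : C.E}
    (h : C.D y e' ≠ 0) : C.deg e' ∈ maxBelow k m p := by
  obtain ⟨e, he, h'⟩ := exists_of_D_ne_zero h
  have : C.deg e = p := by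
    by_contra h''
    exact he (hy e h'')
  rw [← this]
  exact mem_maxBelow_of_coversIn (C.covers _ _ h')

theorem supp_singleton_le (p : Fin n →₀ ℕ) : C.supp {p} ≤ C.supp (Set.Iic p) :=
  supp_mono (Set.singleton_subset_iff.2 (Set.mem_Iic.2 le_rfl))

/-- The cycle y − z is the boundary of something of degree at most p. A boundary has no component in
degree p, since D strictly lowers degrees, and that component of y − z is y. -/
theorem eq_zero_of_D_eq {p : Fin n →₀ ℕ} (hp : ∃ i, m i ≤ p) {y z : C.E → k}
    (hy : y ∈ C.supp {p}) (hz : z ∈ C.supp (Set.Iic p)) (hzp : ∀ e, C.deg e = p → z e = 0)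
    (h : C.D y = C.D z) : y = 0 := by
  obtain ⟨w, hw, hwy⟩ := C.exact p (y - z) (Submodule.sub_mem _ (supp_singleton_le p hy) hz)
    (by rw [map_sub, h, sub_self]) (Or.inr hp)
  funext e
  by_cases he : C.deg e = p
  · have h1 := D_mem_supp_Iio hw e (by rw [he]; exact lt_irrefl p)
    rw [hwy, Pi.sub_apply, hzp e he, sub_zero] at h1
    exact h1
  · exact hy e he

theorem mem_Delta_iff' (p : Pos m) (A : Finset (Fin r)) :
    A ∈ Delta m p ↔ A.sup m ∈ Set.Iio (p : Fin n →₀ ℕ) := mem_Delta_iff p.2.1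

theorem mem_DeltaTilde_iff' (p : Fin n →₀ ℕ) (A : Finset (Fin r)) :
    A ∈ DeltaTilde k m p ↔ A.sup m ∈ belowMax k m p := mem_DeltaTilde_iff

namespace IsComparison

variable {f : (C.E → k) →ₗ[k] Chain k r} (hf : C.IsComparison f)
include hf

theorem map_dimPart (c : ℕ) (y : C.E → k) : f (C.dimPart c y) = cardPart c (f y) := by
  have : (f ∘ₗ C.dimPart c - cardPart c ∘ₗ f : (C.E → k) →ₗ[k] Chain k r) y ∈
      (⊥ : Submodule k (Chain k r)) := by
    refine map_mem_of_single _ _ _ fun e _ => ?_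
    rw [Submodule.mem_bot, LinearMap.sub_apply, LinearMap.comp_apply, LinearMap.comp_apply,
      sub_eq_zero, dimPart_single, ← hf.card e]
    split_ifs with h
    · rw [← h, cardPart_cardPart, hf.card]
    · rw [map_zero]
      funext A
      simp only [cardPart_apply, Pi.zero_apply]
      split_ifs with h1 h2
      · exact absurd (h2.symm.trans h1) h
      · rfl
      · rfl
  rwa [Submodule.mem_bot, LinearMap.sub_apply, sub_eq_zero] at this

theorem map_mem_chains {Δ : LowerSet (Finset (Fin r))} {U : Set (Fin n →₀ ℕ)}
    (hU : IsLowerSet U) (hΔ : ∀ A, A ∈ Δ ↔ A.sup m ∈ U) {y : C.E → k} (hy : y ∈ C.supp U)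
    {c : ℕ} (hc : C.dimPart c y = y) : f y ∈ chains k Δ c :=
  (mem_chains_of_forall hΔ).2 ⟨hf.map_mem hU hy, by rw [← hf.map_dimPart, hc]⟩

theorem map_mem_cycles {Δ : LowerSet (Finset (Fin r))} {U : Set (Fin n →₀ ℕ)}
    (hU : IsLowerSet U) (hΔ : ∀ A, A ∈ Δ ↔ A.sup m ∈ U) {y : C.E → k} (hy : y ∈ C.supp U)
    {c : ℕ} (hc : C.dimPart c y = y) (hD : C.D y = 0) : f y ∈ cycles k Δ c :=
  ⟨hf.map_mem_chains hU hΔ hy hc, (hf.comm y).trans (by rw [hD, map_zero])⟩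

/-- Through f, both homologies are that of the same subcomplex C_{<p} of C, by `supp_Iio_le`. -/
theorem sigma_bijective (p : Pos m) (c : ℕ) : Function.Bijective (sigma k m p c) := by
  have hl := isLowerSet_belowMax (k := k) (m := m) (p : Fin n →₀ ℕ)
  have hT := mem_DeltaTilde_iff' (k := k) (m := m) (p : Fin n →₀ ℕ)
  constructor
  · rw [injective_iff_map_eq_zero]
    intro x hx
    obtain ⟨⟨x, hxc⟩, rfl⟩ := homologyClass_surjective _ _ x
    rw [sigma, inclHomology_homologyClass] at hx
    obtain ⟨w, hw, hwx⟩ := (homologyClass_eq_iff (y := 0)).1 hx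
    rw [mem_chains_of_forall (mem_Delta_iff' p)] at hw
    simp only [ZeroMemClass.coe_zero, sub_zero] at hwx
    have hx1 := (mem_chains_of_forall hT).1 hxc.1
    -- With y = 0 the cone statement says that x is homologous to f of a cycle y1. A second
    -- application, to y1 and the chain w bounding x in Δ_p, makes y1 a boundary D y2 with y2 in
    -- C_{<p}.
    obtain ⟨y1, hy1, x1, hx1', e1, e1'⟩ := hf.exists_of_isLowerSet hl (y := 0)
      (Submodule.zero_mem _) hx1.1 (map_zero _) (by rw [map_zero]; exact hxc.2.symm)
    obtain ⟨y2, hy2, x2, hx2, e2, e2'⟩ := hf.exists_of_isLowerSet (isLowerSet_Iio (p : Fin n →₀ ℕ))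
      (y := y1) (x := w - x1) (supp_mono (belowMax_subset _) hy1)
      (Submodule.sub_mem _ hw.1 (chainsOn_mono (belowMax_subset _) hx1')) e1
      (by rw [map_sub, hwx, e1', add_sub_cancel_right])
    refine (homologyClass_eq_iff (y := 0)).2 ⟨cardPart (c + 1) (f y2 + x1), ?_, ?_⟩
    · exact (mem_chains_of_forall hT).2 ⟨cardPart_mem_chainsOn _ (Submodule.add_mem _
        (hf.map_mem hl (supp_Iio_le _ hy2)) hx1'), cardPart_cardPart _ _⟩
    · rw [boundary_cardPart, map_add, hf.comm, e2, ← e1', hx1.2]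
      simp
  · intro x
    obtain ⟨⟨x, hxc⟩, rfl⟩ := homologyClass_surjective _ _ x
    have hx1 := (mem_chains_of_forall (mem_Delta_iff' p)).1 hxc.1
    obtain ⟨y1, hy1, x1, hx1', e1, e1'⟩ := hf.exists_of_isLowerSet
      (isLowerSet_Iio (p : Fin n →₀ ℕ)) (y := 0)
      (Submodule.zero_mem _) hx1.1 (map_zero _) (by rw [map_zero]; exact hxc.2.symm)
    -- The image under f of a cycle of C_{<p} already lies on Δ̃_p; truncation restores the
    -- dimension.
    refine ⟨homologyClass k _ c ⟨cardPart c (f y1), ?_, ?_⟩, ?_⟩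
    · exact (mem_chains_of_forall hT).2 ⟨cardPart_mem_chainsOn _
        (hf.map_mem hl (supp_Iio_le _ hy1)), cardPart_cardPart _ _⟩
    · exact boundary_cardPart_eq_zero _ (by rw [hf.comm, e1, map_zero])
    · rw [sigma, inclHomology_homologyClass]
      refine homologyClass_eq_iff.2 ⟨cardPart (c + 1) (-x1), ?_, ?_⟩
      · exact (mem_chains_of_forall (mem_Delta_iff' p)).2 ⟨cardPart_mem_chainsOn _
          (Submodule.neg_mem _ hx1'), cardPart_cardPart _ _⟩
      · have h : x = cardPart c (f y1) + cardPart c (boundary k r x1) := by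
          rw [← map_add, ← e1', hx1.2]
        rw [boundary_cardPart, map_neg, map_neg]
        dsimp only
        rw [eq_sub_of_add_eq' h.symm]
        abel

theorem map_D_piece_mem_cycles (p : Pos m) (c : ℕ) (y : C.E → k) :
    f (C.D (C.piece p (c + 1) y)) ∈ cycles k (Delta m p) c :=
  hf.map_mem_cycles (isLowerSet_Iio _) (mem_Delta_iff' p)
    (D_mem_supp_Iio (supp_singleton_le _ (piece_mem_supp _ _ _)))
    (by rw [← D_dimPart, dimPart_piece]) (C.D_D _)

/-- The isomorphism from the part of multidegree `p` in homological degree `c + 1` to the homology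
of `Δ_p`, extended by zero to the other parts. -/
def theta (p : Pos m) (c : ℕ) : (C.E → k) →ₗ[k] RedHomology k (Delta m p) c :=
  homologyClass k (Delta m p) c ∘ₗ
    (f ∘ₗ C.D ∘ₗ C.piece p (c + 1)).codRestrict _ (hf.map_D_piece_mem_cycles p c)

theorem theta_apply (p : Pos m) (c : ℕ) (y : C.E → k) : hf.theta p c y =
    homologyClass k (Delta m p) c ⟨f (C.D (C.piece p (c + 1) y)),
      hf.map_D_piece_mem_cycles p c y⟩ := rfl

theorem theta_piece (p : Pos m) (c : ℕ) (y : C.E → k) :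
    hf.theta p c (C.piece p (c + 1) y) = hf.theta p c y := by
  simp only [theta_apply, piece_piece]

theorem theta_dimPart (p : Pos m) (c : ℕ) (y : C.E → k) :
    hf.theta p c (C.dimPart (c + 1) y) = hf.theta p c y := by
  simp only [theta_apply, piece_dimPart]

/-- If f(Dy) bounds in Δ_p, the quasi-isomorphism gives z in C_{<p} with Dz = Dy, and
`eq_zero_of_D_eq` applies. -/
theorem theta_eq_zero {p : Pos m} {c : ℕ} {y : C.E → k} (h : hf.theta p c y = 0) :
    C.piece p (c + 1) y = 0 := by
  set y0 := C.piece p (c + 1) y with hy0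
  have hy0s : y0 ∈ C.supp {(p : Fin n →₀ ℕ)} := piece_mem_supp _ _ _
  obtain ⟨w, hw, hwx⟩ := (homologyClass_eq_iff (y := 0)).1 h
  rw [mem_chains_of_forall (mem_Delta_iff' p)] at hw
  simp only [ZeroMemClass.coe_zero, sub_zero] at hwx
  obtain ⟨z, hz, -, -, e1, -⟩ := hf.exists_of_isLowerSet (isLowerSet_Iio (p : Fin n →₀ ℕ))
    (D_mem_supp_Iio (supp_singleton_le _ hy0s)) hw.1 (C.D_D _) hwx.symm
  exact eq_zero_of_D_eq (exists_le_of_mem p.2.1 p.2.2) hy0s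
    (supp_mono Set.Iio_subset_Iic_self hz)
    (fun e he => hz e (by rw [he]; exact lt_irrefl (p : Fin n →₀ ℕ))) e1.symm

/-- A cycle of Δ_p is homologous to f(y1) for a cycle y1 of C_{<p}, and y1 = Dz with z of degree at
most p by exactness. Only the component of z in degree p matters: the rest lies in C_{<p} and
contributes a boundary of Δ_p. -/
theorem theta_surjective (p : Pos m) (c : ℕ) : Function.Surjective (hf.theta p c) := by
  classical
  intro x
  obtain ⟨⟨x, hxc⟩, rfl⟩ := homologyClass_surjective _ _ x
  have hx1 := (mem_chains_of_forall (mem_Delta_iff' p)).1 hxc.1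
  obtain ⟨y1, hy1, x1, hx1', e1, e1'⟩ := hf.exists_of_isLowerSet
    (isLowerSet_Iio (p : Fin n →₀ ℕ)) (y := 0)
    (Submodule.zero_mem _) hx1.1 (map_zero _) (by rw [map_zero]; exact hxc.2.symm)
  obtain ⟨z, hz, hzy⟩ := C.exact p y1 (supp_mono Set.Iio_subset_Iic_self hy1) e1
    (Or.inr (exists_le_of_mem p.2.1 p.2.2))
  refine ⟨z, ?_⟩
  rw [theta_apply]
  have hs : C.dimPart (c + 1) z - C.piece p (c + 1) z ∈ C.supp (Set.Iio (p : Fin n →₀ ℕ)) := by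
    intro e he
    rw [Pi.sub_apply, dimPart_apply, piece_apply]
    by_cases h1 : C.deg e = p
    · simp [h1]
    · rw [hz e fun h2 => he (lt_of_le_of_ne h2 h1)]
      simp
  -- The first term undoes the replacement of x by f(y1), the second discards the part of z below p.
  refine homologyClass_eq_iff.2
    ⟨cardPart (c + 1) (-x1) - f (C.dimPart (c + 1) z - C.piece p (c + 1) z), ?_, ?_⟩
  · refine Submodule.sub_mem _ ((mem_chains_of_forall (mem_Delta_iff' p)).2
      ⟨cardPart_mem_chainsOn _ (Submodule.neg_mem _ hx1'), cardPart_cardPart _ _⟩)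
      (hf.map_mem_chains (isLowerSet_Iio _) (mem_Delta_iff' p) hs ?_)
    rw [map_sub, dimPart_piece, sub_left_inj]
    funext e
    simp only [dimPart_apply]
    split_ifs <;> rfl
  · have h : x = cardPart c (f y1) + cardPart c (boundary k r x1) := by
      rw [← map_add, ← e1', hx1.2]
    rw [map_sub, boundary_cardPart, map_neg, map_neg, hf.comm, map_sub, D_dimPart, hzy, map_sub,
      hf.map_dimPart]
    dsimp only
    rw [eq_sub_of_add_eq' h.symm]
    abel

theorem sigmaInv_theta (p : Pos m) (c : ℕ) (y : C.E → k)
    (h : f (C.D (C.piece p (c + 1) y)) ∈ cycles k (DeltaTilde k m p) c) :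
    sigmaInv k m p c (hf.theta p c y) = homologyClass k (DeltaTilde k m p) c ⟨_, h⟩ := by
  have hb := hf.sigma_bijective p c
  rw [sigmaInv, dif_pos hb]
  exact (LinearEquiv.symm_apply_eq (LinearEquiv.ofBijective (sigma k m p c) hb)).2 rfl

/-- The representative f(Dy0) lies on Δ̃_p, so inverting σ costs nothing, and the decomposition of
Dy0 by degree yields chains c₁, c₂ for the connecting map. -/
theorem phi_theta (p β : Pos m) (i : ℕ) (y : C.E → k) :
    phi k m p β i (hf.theta p (i + 1) y) = hf.theta β i (C.D (C.piece p (i + 2) y)) := by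
  classical
  set y0 := C.piece p (i + 2) y with hy0
  have hy0s : y0 ∈ C.supp {(p : Fin n →₀ ℕ)} := piece_mem_supp _ _ _
  have hmax : ∀ e, C.D y0 e ≠ 0 → C.deg e ∈ maxBelow k m p := fun e he => deg_mem_maxBelow hy0s he
  have hdim : C.dimPart (i + 1) (C.D y0) = C.D y0 := by rw [← D_dimPart, dimPart_piece]
  by_cases hβ : (β : Fin n →₀ ℕ) ∈ maxBelow k m p
  · have hcyc : f (C.D y0) ∈ cycles k (DeltaTilde k m p) (i + 1) := by
      refine hf.map_mem_cycles (isLowerSet_belowMax _) (mem_DeltaTilde_iff' _) ?_ hdim (C.D_D _)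
      intro e he
      by_contra h
      exact he ⟨_, hmax e h, le_rfl⟩
    -- Take c₁ = f(z), carried by ⟨A_β⟩, and c₂ = f(z − Dy0), carried by the other ⟨A_{β_j}⟩; then d
    -- c₁ = f(Dz) represents `theta` at β.
    set z := C.piece β (i + 1) (C.D y0) with hz
    have h1 : f z ∈ chains k (LowerSet.Iic (label m β)) (i + 1) := by
      refine hf.map_mem_chains (isLowerSet_Iic (β : Fin n →₀ ℕ)) (fun A => ?_)
        (supp_singleton_le _ (piece_mem_supp _ _ _)) (dimPart_piece _ _ _)
      rw [LowerSet.mem_Iic_iff]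
      exact subset_label_iff
    have h2 : f (z - C.D y0) ∈ chains k (DeltaOther k m p β) (i + 1) := by
      refine hf.map_mem_chains (U := {q | ∃ γ ∈ maxBelow k m p \ {(β : Fin n →₀ ℕ)}, q ≤ γ})
        (fun _ _ hba ⟨γ, hγ, h⟩ => ⟨γ, hγ, hba.trans h⟩) (fun A => ?_) ?_ ?_
      · constructor
        · intro h
          obtain ⟨_, ⟨γ, hγ, rfl⟩, hA⟩ := mem_lowerClosure.1 h
          exact ⟨γ, hγ, subset_label_iff.1 hA⟩
        · rintro ⟨γ, hγ, hA⟩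
          exact mem_lowerClosure.2 ⟨_, ⟨γ, hγ, rfl⟩, subset_label_iff.2 hA⟩
      · intro e he
        rw [Pi.sub_apply, hz, piece_apply]
        by_cases h0 : C.D y0 e = 0
        · simp [h0]
        · have hd : C.dim e = i + 1 := by
            by_contra h
            rw [← hdim, dimPart_apply, if_neg h] at h0
            exact h0 rfl
          have hdeg : C.deg e = β := by
            by_contra h
            exact he ⟨_, ⟨hmax e h0, h⟩, le_rfl⟩
          rw [if_pos ⟨hdeg, hd⟩, sub_self]
      · rw [map_sub, hdim, dimPart_piece]
    rw [phi, dif_pos hβ, LinearMap.comp_apply, LinearMap.comp_apply, hf.sigmaInv_theta _ _ _ hcyc,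
      connecting_apply _ _ _ h1 h2 (by rw [map_sub, sub_sub_cancel]),
      inclHomology_homologyClass, theta_apply]
    congr 1
    exact Subtype.ext (hf.comm _)
  · rw [phi, dif_neg hβ, LinearMap.zero_apply, ← hf.theta_piece]
    have : C.piece β (i + 1) (C.D y0) = 0 := by
      funext e
      rw [piece_apply]
      split_ifs with h
      · by_contra h0
        exact hβ (h.1 ▸ hmax e h0)
      · rfl
    rw [this, map_zero]

/-- If Δ_p has no vertex, Dy0 is a multiple of `bot`, which f sends to the empty face. If it has
one, H̃_{-1}(Δ_p) = 0, and injectivity of `theta` gives y0 = 0. -/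
theorem phiOne_theta (p : Pos m) (y : C.E → k) : phiOne k m p (hf.theta p 0 y) =
    C.D (C.piece p 1 y) C.bot • emptyClass k (LowerSet.mem_Iic_iff.2 le_rfl) := by
  set y0 := C.piece p 1 y with hy0
  by_cases h : Delta m p ≤ emptyFace r
  · have hdim : C.dimPart 0 (C.D y0) = C.D y0 := by rw [← D_dimPart, dimPart_piece]
    have key : C.D y0 = C.D y0 C.bot • (Pi.single C.bot 1 : C.E → k) := by
      funext e
      by_cases he : e = C.bot
      · subst he; simp
      · rw [← hdim, dimPart_apply, if_neg (mt (C.dim_eq_zero e).1 he)]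
        simp [he]
    rw [phiOne, dif_pos h, theta_apply, inclHomology_homologyClass, emptyClass, ← map_smul]
    congr 1
    refine Subtype.ext ?_
    have := congrArg f key
    rw [map_smul, hf.bot] at this
    exact this
  · rw [phiOne, dif_neg h, LinearMap.zero_apply]
    have hA : ∃ A ∈ Delta m p, A ≠ ∅ := by
      by_contra! h'
      exact h fun A hA => LowerSet.mem_Iic_iff.2 (h' A hA).le
    obtain ⟨A, hA, hne⟩ := hA
    obtain ⟨i, hi⟩ := Finset.nonempty_iff_ne_empty.2 hne
    have h0 := hf.theta_eq_zero (redHomology_zero_eq_zero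
      ((Delta m p).lower (Finset.singleton_subset_iff.2 hi) hA) (hf.theta p 0 y))
    rw [hy0, h0, map_zero, Pi.zero_apply, zero_smul]

end IsComparison

end BettiComplex


/-! ### Coordinates of 𝓓(L_M), its low degrees and its finiteness. -/

section Construction

variable {k : Type u} [Field k] {n r : ℕ} {m : Fin r → Fin n →₀ ℕ}

theorem Dmap_zero_apply (x : DSpace k m 1) :
    Dmap k m 0 x = ∑ p : Pos m, phiOne k m p (summandProj k m p 0 x) := by
  rw [Dmap, LinearMap.sum_apply]
  rfl

theorem Dmap_succ_apply (i : ℕ) (x : DSpace k m (i + 2)) :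
    Dmap k m (i + 1) x = ∑ p : Pos m, ∑ β : Pos m,
      summandIncl k m β i (phi k m p β i (summandProj k m p (i + 1) x)) := by
  rw [Dmap, LinearMap.sum_apply]
  refine Finset.sum_congr rfl fun p _ => ?_
  rw [LinearMap.sum_apply]
  rfl

theorem summandProj_summandIncl_self (p : Pos m) (i : ℕ) (x : RedHomology k (Delta m p) i) :
    summandProj k m p i (summandIncl k m p i x) = x :=
  Pi.single_eq_same (M := fun q : Pos m => RedHomology k (Delta m q) i) p x

theorem summandProj_summandIncl_of_ne {p q : Pos m} (h : q ≠ p) (i : ℕ)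
    (x : RedHomology k (Delta m p) i) : summandProj k m q i (summandIncl k m p i x) = 0 :=
  Pi.single_eq_of_ne (M := fun q : Pos m => RedHomology k (Delta m q) i) h x

theorem DSpace_succ_ext {i : ℕ} {x y : DSpace k m (i + 1)}
    (h : ∀ p, summandProj k m p i x = summandProj k m p i y) : x = y := funext h

theorem summandProj_Dmap (i : ℕ) (x : DSpace k m (i + 2)) (β : Pos m) :
    summandProj k m β i (Dmap k m (i + 1) x) =
      ∑ p : Pos m, phi k m p β i (summandProj k m p (i + 1) x) := by
  rw [Dmap_succ_apply, map_sum]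
  refine Finset.sum_congr rfl fun p _ => ?_
  rw [map_sum, Finset.sum_eq_single_of_mem β (Finset.mem_univ _),
    summandProj_summandIncl_self]
  exact fun γ _ hγ => summandProj_summandIncl_of_ne hγ.symm _ _

theorem sum_summandIncl (i : ℕ) (x : DSpace k m (i + 1)) :
    ∑ p : Pos m, summandIncl k m p i (summandProj k m p i x) = x := by
  refine DSpace_succ_ext fun q => ?_
  rw [map_sum, Finset.sum_eq_single_of_mem q (Finset.mem_univ _), summandProj_summandIncl_self]
  exact fun γ _ hγ => summandProj_summandIncl_of_ne hγ.symm _ _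

theorem DBasis_succ_apply (b : HomologyBases k m) (i : ℕ) (a : DIndex k m (i + 1)) :
    DBasis k m b (i + 1) a = summandIncl k m a.1 i (b.basis a.1 i a.2) := by
  exact Pi.basis_apply _ _

theorem DBasis_succ_repr (b : HomologyBases k m) (i : ℕ) (x : DSpace k m (i + 1))
    (a : DIndex k m (i + 1)) : (DBasis k m b (i + 1)).repr x a =
      (b.basis a.1 i).repr (summandProj k m a.1 i x) a.2 := by
  exact Pi.basis_repr _ _ _

/-! ### Homological degrees zero and one -/

theorem empty_mem_Delta (p : Pos m) : ∅ ∈ Delta m p :=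
  (mem_Delta_iff p.2.1).2 (lt_of_le_of_ne (zero_le (a := (p : Fin n →₀ ℕ))) p.2.2.symm)

theorem Delta_le_emptyFace_of_ne_zero {p : Pos m} {x : RedHomology k (Delta m p) 0}
    (hx : x ≠ 0) : Delta m p ≤ emptyFace r := by
  refine fun A hA => LowerSet.mem_Iic_iff.2 fun i hi => (hx ?_).elim
  exact redHomology_zero_eq_zero ((Delta m p).lower (Finset.singleton_subset_iff.2 hi) hA) x

theorem emptyClass_ne_zero_of_le {Δ : LowerSet (Finset (Fin r))} (h : ∅ ∈ Δ)
    (hΔ : Δ ≤ emptyFace r) : emptyClass k h ≠ 0 := fun h0 => by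
  have : inclHomology k hΔ 0 (emptyClass k h) = 0 := by rw [h0, map_zero]
  exact emptyClass_ne_zero this

theorem finrank_of_le_emptyFace {p : Pos m} (h : Delta m p ≤ emptyFace r) :
    Module.finrank k (RedHomology k (Delta m p) 0) = 1 :=
  (finrank_eq_one_iff_of_nonzero' _ (emptyClass_ne_zero_of_le (empty_mem_Delta p) h)).2
    (exists_smul_emptyClass _)

/-- The atoms of the lcm-lattice. -/
def atom (m : Fin r → Fin n →₀ ℕ) (hm_ne : ∀ i, m i ≠ 0) (j : Fin r) : Pos m :=
  ⟨m j, ⟨{j}, by simp⟩, hm_ne j⟩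

theorem Delta_atom_le (hm_ne : ∀ i, m i ≠ 0) (hm_min : ∀ i j, m i ≤ m j → i = j) (j : Fin r) :
    Delta m (atom m hm_ne j) ≤ emptyFace r := by
  refine fun A hA => LowerSet.mem_Iic_iff.2 fun i hi => ?_
  have h1 : A.sup m < m j := (mem_Delta_iff (atom m hm_ne j).2.1).1 hA
  have h2 : m i < m j := (Finset.le_sup (f := m) hi).trans_lt h1
  rw [hm_min i j h2.le] at h2
  exact (lt_irrefl _ h2).elim

theorem exists_atom_eq (hm_ne : ∀ i, m i ≠ 0) {p : Pos m} (h : Delta m p ≤ emptyFace r) :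
    ∃ j, atom m hm_ne j = p := by
  obtain ⟨i, hi⟩ := BettiComplex.exists_le_of_mem p.2.1 p.2.2
  refine ⟨i, Subtype.ext ?_⟩
  by_contra hne
  have : {i} ∈ Delta m p := (mem_Delta_iff p.2.1).2 (by
    rw [Finset.sup_singleton]
    exact lt_of_le_of_ne hi hne)
  exact Finset.singleton_ne_empty i (Finset.subset_empty.1 (LowerSet.mem_Iic_iff.1 (h this)))

theorem Delta_le_of_index (b : HomologyBases k m) (a : DIndex k m 1) :
    Delta m a.1 ≤ emptyFace r :=
  Delta_le_emptyFace_of_ne_zero ((b.basis a.1 0).ne_zero a.2)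

variable (k) in
/-- The basis of `𝓓_1` is indexed by the atoms. -/
theorem exists_equiv_atoms (b : HomologyBases k m) (hm_ne : ∀ i, m i ≠ 0)
    (hm_min : ∀ i j, m i ≤ m j → i = j) :
    ∃ w : DIndex k m 1 ≃ Fin r, ∀ a : DIndex k m 1, (a.1 : Fin n →₀ ℕ) = m (w a) := by
  have h1 : ∀ j, Module.finrank k (RedHomology k (Delta m (atom m hm_ne j)) 0) = 1 :=
    fun j => finrank_of_le_emptyFace (Delta_atom_le hm_ne hm_min j)
  -- The homology at an atom is one-dimensional, so 0 is the only index there.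
  let g : Fin r → DIndex k m 1 := fun j => ⟨atom m hm_ne j, ⟨0, by rw [h1 j]; exact one_pos⟩⟩
  have hg : Function.Bijective g := by
    constructor
    · intro i j hij
      have : m i = m j := congrArg (fun a : DIndex k m 1 => (a.1 : Fin n →₀ ℕ)) hij
      exact hm_min i j this.le
    · rintro ⟨p, s⟩
      obtain ⟨j, rfl⟩ := exists_atom_eq hm_ne (Delta_le_of_index b ⟨p, s⟩)
      refine ⟨j, Sigma.ext rfl (heq_of_eq (Fin.ext ?_))⟩
      have := s.2.trans_eq (h1 j)
      change 0 = (s : ℕ)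
      omega
  refine ⟨(Equiv.ofBijective g hg).symm, fun a => ?_⟩
  obtain ⟨j, rfl⟩ := hg.2 a
  rw [Equiv.ofBijective_symm_apply_apply]
  rfl

theorem Dmap_zero_DBasis (b : HomologyBases k m) (a : DIndex k m 1) (o : Unit) :
    Dmap k m 0 (DBasis k m b 1 a) = DBasis k m b 0 o := by
  have h := Delta_le_of_index b a
  rw [DBasis_succ_apply, Dmap_zero_apply, Finset.sum_eq_single_of_mem a.1 (Finset.mem_univ _),
    summandProj_summandIncl_self, phiOne, dif_pos h, b.basis_empty a.1 (empty_mem_Delta _)]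
  · exact b.bottom_empty.symm
  · intro q _ hq
    rw [summandProj_summandIncl_of_ne hq, map_zero]

theorem subsingleton_redHomology (Δ : LowerSet (Finset (Fin r))) {c : ℕ} (hc : r < c) :
    Subsingleton (RedHomology k Δ c) := by
  refine subsingleton_of_forall_eq 0 fun x => ?_
  obtain ⟨⟨x, hx⟩, rfl⟩ := homologyClass_surjective _ _ x
  have : (⟨x, hx⟩ : cycles k Δ c) = 0 := by
    refine Subtype.ext (funext fun A => hx.1 A fun h => ?_)
    have := A.card_le_univ
    rw [Fintype.card_fin] at this
    omega
  rw [this, map_zero]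

/-- 𝓓_{j+1} is built from faces with j elements, and there are none for j > r. -/
theorem isEmpty_DIndex {i : ℕ} (hi : r + 2 ≤ i) : IsEmpty (DIndex k m i) := by
  obtain ⟨i, rfl⟩ : ∃ j, i = j + 1 := ⟨i - 1, by omega⟩
  refine ⟨fun ⟨p, s⟩ => ?_⟩
  have := subsingleton_redHomology (k := k) (Delta m p) (c := i) (by omega)
  have h0 := Module.finrank_zero_of_subsingleton (R := k) (M := RedHomology k (Delta m p) i)
  have := s.2
  omega

instance finite_DIndex (i : ℕ) : Finite (DIndex k m i) := by
  rcases i with _ | i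
  · exact inferInstanceAs (Finite Unit)
  · exact inferInstanceAs
      (Finite (Σ p : Pos m, Fin (Module.finrank k (RedHomology k (Delta m p) i))))

end Construction

/-! ### The isomorphism of C with 𝓓(L_M). -/

namespace BettiComplex

variable {k : Type u} [Field k] {n r : ℕ} {m : Fin r → Fin n →₀ ℕ} {C : BettiComplex k m}

/-- In positive homological degree every multidegree is an element of L_M other than 1, so the
pieces exhaust the degree. -/
theorem sum_piece (c : ℕ) (y : C.E → k) :
    ∑ p : Pos m, C.piece p (c + 1) y = C.dimPart (c + 1) y := by
  classical
  funext e
  rw [Finset.sum_apply, dimPart_apply]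
  split_ifs with h
  · have hd := C.deg_mem e (by omega)
    rw [Finset.sum_eq_single_of_mem (⟨C.deg e, hd.1.1, hd.2⟩ : Pos m) (Finset.mem_univ _)]
    · rw [piece_apply, if_pos ⟨rfl, h⟩]
    · intro p _ hp
      rw [piece_apply, if_neg fun h' => hp (Subtype.ext h'.1.symm)]
  · refine Finset.sum_eq_zero fun p _ => ?_
    rw [piece_apply, if_neg fun h' => h h'.2]

namespace IsComparison

variable {f : (C.E → k) →ₗ[k] Chain k r} (hf : C.IsComparison f)
include hf

/-- The isomorphism from the part in homological degree `i` to `𝓓_i`, extended by zero to the other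
parts. -/
def toDSpace : ∀ i, (C.E → k) →ₗ[k] DSpace k m i
  | 0 => (LinearMap.proj C.bot : (C.E → k) →ₗ[k] k).smulRight
      (emptyClass k (LowerSet.mem_Iic_iff.2 le_rfl) : RedHomology k (emptyFace r) 0)
  | i + 1 => (LinearMap.pi fun p => hf.theta p i :
      (C.E → k) →ₗ[k] ∀ p : Pos m, RedHomology k (Delta m p) i)

theorem toDSpace_zero (y : C.E → k) : hf.toDSpace 0 y =
    (y C.bot • emptyClass k (LowerSet.mem_Iic_iff.2 le_rfl) : RedHomology k (emptyFace r) 0) := rfl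

theorem summandProj_toDSpace (p : Pos m) (i : ℕ) (y : C.E → k) :
    summandProj k m p i (hf.toDSpace (i + 1) y) = hf.theta p i y := rfl

theorem toDSpace_dimPart (i : ℕ) (y : C.E → k) :
    hf.toDSpace i (C.dimPart i y) = hf.toDSpace i y := by
  rcases i with _ | i
  · rw [toDSpace_zero, toDSpace_zero, dimPart_apply, if_pos dim_bot]
  · exact DSpace_succ_ext fun p => hf.theta_dimPart p i y

theorem dimPart_eq_zero {i : ℕ} {y : C.E → k} (h : hf.toDSpace i y = 0) : C.dimPart i y = 0 := by
  rcases i with _ | i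
  · rw [toDSpace_zero] at h
    have h0 : y C.bot = 0 := (smul_eq_zero.1 h).resolve_right emptyClass_ne_zero
    funext e
    rw [dimPart_apply]
    split_ifs with he
    · rw [(C.dim_eq_zero e).1 he, h0]; rfl
    · rfl
  · rw [← sum_piece]
    exact Finset.sum_eq_zero fun p _ => hf.theta_eq_zero (congrArg (summandProj k m p i) h)

theorem toDSpace_surjective (i : ℕ) : Function.Surjective (hf.toDSpace i) := by
  intro x
  rcases i with _ | i
  · obtain ⟨a, ha⟩ := exists_smul_emptyClass (k := k) (Δ := emptyFace r)
      (LowerSet.mem_Iic_iff.2 le_rfl) x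
    refine ⟨Pi.single C.bot a, ?_⟩
    rw [toDSpace_zero, Pi.single_eq_same]
    exact ha
  · choose y hy using fun p : Pos m => hf.theta_surjective p i (summandProj k m p i x)
    refine ⟨∑ p : Pos m, C.piece p (i + 1) (y p), DSpace_succ_ext fun q => ?_⟩
    rw [summandProj_toDSpace, map_sum, Finset.sum_eq_single_of_mem q (Finset.mem_univ _),
      theta_piece, hy]
    intro p _ hp
    have : C.piece q (i + 1) (C.piece p (i + 1) (y p)) = 0 := by
      classical
      funext e
      rw [piece_apply]
      split_ifs with h
      · rw [piece_apply, if_neg fun h' => hp (Subtype.ext (h'.1.symm.trans h.1))]; rfl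
      · rfl
    rw [← theta_piece, this, map_zero]

/-- Splitting y over the multidegrees p reduces this to `phi_theta` and `phiOne_theta`. That 𝓓(L_M)
is a complex follows from it. -/
theorem Dmap_toDSpace (i : ℕ) (y : C.E → k) :
    Dmap k m i (hf.toDSpace (i + 1) y) = hf.toDSpace i (C.D y) := by
  rw [← hf.toDSpace_dimPart i, ← D_dimPart, ← sum_piece]
  rcases i with _ | i
  · rw [Dmap_zero_apply, toDSpace_zero, map_sum, Finset.sum_apply, Finset.sum_smul]
    exact Finset.sum_congr rfl fun p _ => hf.phiOne_theta p y
  · refine DSpace_succ_ext fun β => ?_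
    rw [summandProj_Dmap, map_sum, map_sum, map_sum]
    exact Finset.sum_congr rfl fun p _ => hf.phi_theta p β i y

theorem Dmap_Dmap (i : ℕ) (x : DSpace k m (i + 2)) : Dmap k m i (Dmap k m (i + 1) x) = 0 := by
  obtain ⟨y, rfl⟩ := hf.toDSpace_surjective _ x
  rw [hf.Dmap_toDSpace, hf.Dmap_toDSpace, C.D_D, map_zero]

theorem linearIndependent_toDSpace (i : ℕ) : LinearIndependent k
    fun e : {e : C.E // C.dim e = i} => hf.toDSpace i (Pi.single (e : C.E) 1) := by
  rw [Fintype.linearIndependent_iff]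
  intro g hg e
  have h1 : hf.toDSpace i (∑ e : {e : C.E // C.dim e = i}, g e • Pi.single (e : C.E) (1 : k)) =
      0 := by
    rw [map_sum, ← hg]
    exact Finset.sum_congr rfl fun e _ => map_smul _ _ _
  have h2 := congrFun (hf.dimPart_eq_zero h1) e
  rw [dimPart_apply, if_pos e.2, Finset.sum_apply,
    Finset.sum_eq_single_of_mem e (Finset.mem_univ _)] at h2
  · simpa using h2
  · intro e' _ he'
    rw [Pi.smul_apply, Pi.single_eq_of_ne fun h => he' (Subtype.ext h.symm), smul_zero]

theorem top_le_span_toDSpace (i : ℕ) : ⊤ ≤ Submodule.span k (Set.range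
    fun e : {e : C.E // C.dim e = i} => hf.toDSpace i (Pi.single (e : C.E) 1)) := by
  rintro x -
  obtain ⟨y, rfl⟩ := hf.toDSpace_surjective _ x
  refine map_mem_of_single _ _ _ fun e _ => ?_
  by_cases he : C.dim e = i
  · exact Submodule.subset_span ⟨⟨e, he⟩, rfl⟩
  · rw [← toDSpace_dimPart, dimPart_single, if_neg he, map_zero]
    exact Submodule.zero_mem _

/-- The basis of `𝓓_i` that corresponds to the given basis in homological degree `i`. -/
def basis (i : ℕ) : Module.Basis {e : C.E // C.dim e = i} k (DSpace k m i) :=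
  Module.Basis.mk (hf.linearIndependent_toDSpace i) (hf.top_le_span_toDSpace i)

theorem basis_apply (i : ℕ) (e : {e : C.E // C.dim e = i}) :
    hf.basis i e = hf.toDSpace i (Pi.single (e : C.E) 1) :=
  Module.Basis.mk_apply _ _ _

/-- Together with `Dmap_toDSpace`: in the transferred bases, φ has the matrix of D. -/
theorem basis_repr (i : ℕ) (y : C.E → k) (e : {e : C.E // C.dim e = i}) :
    (hf.basis i).repr (hf.toDSpace i y) e = y e := by
  have : hf.toDSpace i y = ∑ e : {e : C.E // C.dim e = i}, y e • hf.basis i e := by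
    have h1 : C.dimPart i y =
        ∑ e : {e : C.E // C.dim e = i}, y e • (Pi.single (e : C.E) 1 : C.E → k) := by
      funext e
      rw [dimPart_apply, Finset.sum_apply]
      split_ifs with he
      · rw [Finset.sum_eq_single_of_mem ⟨e, he⟩ (Finset.mem_univ _)]
        · simp
        · intro e' _ he'
          rw [Pi.smul_apply, Pi.single_eq_of_ne fun h => he' (Subtype.ext h.symm), smul_zero]
      · refine (Finset.sum_eq_zero fun e' _ => ?_).symm
        rw [Pi.smul_apply, Pi.single_eq_of_ne fun h => he (by rw [h]; exact e'.2), smul_zero]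
    rw [← toDSpace_dimPart, h1, map_sum]
    exact Finset.sum_congr rfl fun e _ => by rw [map_smul, basis_apply]
  rw [this, Module.Basis.repr_sum_self]

/-- The reason why lcms recover multidegrees. If the nonzero components of φ(x) lie in degrees
dividing q, then Dy0 is a boundary from degrees dividing q by exactness, and q ≠ p would force y0 =
0 by minimality. -/
theorem eq_of_phi_le {p : Pos m} {i : ℕ} {x : RedHomology k (Delta m p) (i + 1)} (hx : x ≠ 0)
    {q : Fin n →₀ ℕ} (hq : q ≤ p) (h : ∀ β : Pos m, phi k m p β i x ≠ 0 → (β : Fin n →₀ ℕ) ≤ q) :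
    q = p := by
  obtain ⟨y, rfl⟩ := hf.theta_surjective p (i + 1) x
  by_contra hqp
  set y0 := C.piece p (i + 2) y with hy0
  have hdim : C.dimPart (i + 1) (C.D y0) = C.D y0 := by rw [← D_dimPart, dimPart_piece]
  have hd : ∀ e, C.D y0 e ≠ 0 → C.dim e = i + 1 := fun e he => by
    by_contra h'
    rw [← hdim, dimPart_apply, if_neg h'] at he
    exact he rfl
  have hs : C.D y0 ∈ C.supp (Set.Iic q) := by
    classical
    intro e he
    by_contra h0
    have hd' := hd e h0
    have hm := C.deg_mem e (by omega)
    let β : Pos m := ⟨C.deg e, hm.1.1, hm.2⟩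
    refine he (h β fun h' => h0 ?_)
    rw [hf.phi_theta] at h'
    have := congrFun (hf.theta_eq_zero h') e
    rwa [piece_apply, if_pos ⟨rfl, hd'⟩] at this
  -- No generator need divide q a priori; exactness still applies because Dy0 has positive
  -- homological degree and so no component at `bot`.
  obtain ⟨z, hz, hzy⟩ := C.exact q _ hs (C.D_D _) (Or.inl (by
    by_contra h0
    have := hd _ h0
    rw [dim_bot] at this
    omega))
  have : y0 = 0 := eq_zero_of_D_eq (exists_le_of_mem p.2.1 p.2.2) (piece_mem_supp _ _ _)
    (supp_mono (Set.Iic_subset_Iic.2 hq) hz)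
    (fun e he => hz e fun h' => hqp (le_antisymm hq (he ▸ h'))) hzy.symm
  refine hx ?_
  rw [← theta_piece, ← hy0, this, map_zero]

end IsComparison

end BettiComplex


open MvPolynomial (monomial)

/-! ### Homogeneous elements and the matrices of 𝓕(L_M). -/

section Homogeneous

variable {k : Type u} [Field k] {n r : ℕ} {m : Fin r → Fin n →₀ ℕ}

variable (k m) in
/-- An element of `𝓓_i` is homogeneous of degree `α` if it is in the summand of `α`. -/
def IsHomogeneousOf : ∀ i, DSpace k m i → (Fin n →₀ ℕ) → Prop
  | 0 => fun _ α => α = 0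
  | i + 1 => fun x α => ∀ p : Pos m, (p : Fin n →₀ ℕ) ≠ α → summandProj k m p i x = 0

variable (k m) in
/-- The `k`-linear map `𝓓_i → 𝓓_i ⊗ S` that multiplies the summand of `β` by `α / β`. -/
def twist (α : Fin n →₀ ℕ) : ∀ i, DSpace k m i →ₗ[k] MvPolynomial (Fin n) k ⊗[k] DSpace k m i
  | 0 => TensorProduct.mk k (MvPolynomial (Fin n) k) (DSpace k m 0) (monomial α 1)
  | i + 1 => ∑ β : Pos m, TensorProduct.mk k (MvPolynomial (Fin n) k) (DSpace k m (i + 1))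
      (monomial (α - (β : Fin n →₀ ℕ)) 1) ∘ₗ summandIncl k m β i ∘ₗ summandProj k m β i

theorem twist_zero (α : Fin n →₀ ℕ) (z : DSpace k m 0) :
    twist k m α 0 z = monomial α (1 : k) ⊗ₜ z := rfl

theorem twist_succ (α : Fin n →₀ ℕ) (i : ℕ) (z : DSpace k m (i + 1)) :
    twist k m α (i + 1) z = ∑ β : Pos m, monomial (α - (β : Fin n →₀ ℕ)) (1 : k) ⊗ₜ
      summandIncl k m β i (summandProj k m β i z) := by
  rw [twist, LinearMap.sum_apply]
  rfl

theorem twist_of_isHomogeneousOf {i : ℕ} {z : DSpace k m i} {γ : Fin n →₀ ℕ}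
    (hz : IsHomogeneousOf k m i z γ) (α : Fin n →₀ ℕ) :
    twist k m α i z = monomial (α - γ) (1 : k) ⊗ₜ z := by
  rcases i with _ | i
  · obtain rfl : γ = 0 := hz
    rw [twist_zero, tsub_zero]
  · rw [twist_succ]
    nth_rewrite 2 [← sum_summandIncl i z]
    rw [TensorProduct.tmul_sum]
    refine Finset.sum_congr rfl fun β _ => ?_
    by_cases hβ : (β : Fin n →₀ ℕ) = γ
    · subst hβ; rfl
    · rw [hz β hβ, map_zero, TensorProduct.tmul_zero, TensorProduct.tmul_zero]

/-- The restriction of `φ_1` to the summand of `p`. -/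
def DmapOne (p : Pos m) : DSpace k m 1 →ₗ[k] DSpace k m 0 := phiOne k m p ∘ₗ summandProj k m p 0

theorem Dmap_zero : Dmap k m 0 = ∑ p : Pos m, DmapOne p := rfl

theorem posetDifferential_zero : posetDifferential k m 0 =
    ∑ p : Pos m, monomial (p : Fin n →₀ ℕ) (1 : k) • (DmapOne p).baseChange _ := rfl

/-- For x in the summand of α only p = α contributes, so the monomial factors α/β depend on the
target alone. -/
theorem posetDifferential_tmul {i : ℕ} {x : DSpace k m (i + 1)} {α : Fin n →₀ ℕ}
    (hx : IsHomogeneousOf k m (i + 1) x α) :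
    posetDifferential k m i (1 ⊗ₜ x) = twist k m α i (Dmap k m i x) := by
  rcases i with _ | i
  · rw [posetDifferential_zero, twist_zero, Dmap_zero, LinearMap.sum_apply, LinearMap.sum_apply,
      TensorProduct.tmul_sum]
    refine Finset.sum_congr rfl fun p _ => ?_
    rw [LinearMap.smul_apply, LinearMap.baseChange_tmul, TensorProduct.smul_tmul', smul_eq_mul,
      mul_one]
    by_cases hp : (p : Fin n →₀ ℕ) = α
    · subst hp; rfl
    · have : DmapOne p x = 0 := (congrArg (phiOne k m p) (hx p hp)).trans (map_zero _)
      rw [this, TensorProduct.tmul_zero, TensorProduct.tmul_zero]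
  · rw [posetDifferential, twist_succ, LinearMap.sum_apply]
    simp only [summandProj_Dmap, map_sum, TensorProduct.tmul_sum]
    rw [Finset.sum_comm]
    refine Finset.sum_congr rfl fun p _ => ?_
    rw [LinearMap.sum_apply]
    refine Finset.sum_congr rfl fun β _ => ?_
    rw [LinearMap.smul_apply, LinearMap.baseChange_tmul, TensorProduct.smul_tmul', smul_eq_mul,
      mul_one, LinearMap.comp_apply, LinearMap.comp_apply]
    by_cases hp : (p : Fin n →₀ ℕ) = α
    · subst hp; rfl
    · rw [hx p hp, map_zero, map_zero, TensorProduct.tmul_zero, TensorProduct.tmul_zero]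

/-- Stated for any homogeneous basis, since it serves both the prescribed homology bases and the
basis transferred from the given resolution. -/
theorem posetDifferential_eq_sum {i : ℕ} {x : DSpace k m (i + 1)} {α : Fin n →₀ ℕ}
    (hx : IsHomogeneousOf k m (i + 1) x α) {ι : Type*} [Fintype ι]
    (B : Module.Basis ι k (DSpace k m i)) (g : ι → Fin n →₀ ℕ)
    (hB : ∀ u, IsHomogeneousOf k m i (B u) (g u)) :
    posetDifferential k m i (1 ⊗ₜ x) =
      ∑ u, monomial (α - g u) (B.repr (Dmap k m i x) u) •
        Algebra.TensorProduct.basis (MvPolynomial (Fin n) k) B u := by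
  rw [posetDifferential_tmul hx]
  nth_rewrite 1 [← B.sum_repr (Dmap k m i x)]
  rw [map_sum]
  refine Finset.sum_congr rfl fun u _ => ?_
  rw [map_smul, twist_of_isHomogeneousOf (hB u), Algebra.TensorProduct.basis_apply,
    TensorProduct.smul_tmul', TensorProduct.smul_tmul', smul_eq_mul, mul_one,
    MvPolynomial.smul_monomial, smul_eq_mul, mul_one]

theorem isHomogeneousOf_DBasis (b : HomologyBases k m) (i : ℕ) (a : DIndex k m i) :
    IsHomogeneousOf k m i (DBasis k m b i a) (posetDegree k m i a) := by
  rcases i with _ | i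
  · exact rfl
  · intro p hp
    rw [DBasis_succ_apply]
    exact summandProj_summandIncl_of_ne (fun h => hp (by rw [h]; rfl)) _ _

theorem posetSequence_d_basis (b : HomologyBases k m) (i : ℕ) [Fintype (DIndex k m i)]
    (a : DIndex k m (i + 1)) :
    posetDifferential k m i
      (Algebra.TensorProduct.basis (MvPolynomial (Fin n) k) (DBasis k m b (i + 1)) a) =
    ∑ u, monomial (posetDegree k m (i + 1) a - posetDegree k m i u)
        ((DBasis k m b i).repr (Dmap k m i (DBasis k m b (i + 1) a)) u) •
        Algebra.TensorProduct.basis (MvPolynomial (Fin n) k) (DBasis k m b i) u := by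
  rw [Algebra.TensorProduct.basis_apply]
  exact posetDifferential_eq_sum (isHomogeneousOf_DBasis b _ a) _ _ (isHomogeneousOf_DBasis b i)

theorem posetSequence_entry (b : HomologyBases k m) (i : ℕ) (a : DIndex k m (i + 1))
    (c : DIndex k m i) : (posetSequence k m b).entry i a c =
      monomial (posetDegree k m (i + 1) a - posetDegree k m i c)
        ((DBasis k m b i).repr (Dmap k m i (DBasis k m b (i + 1) a)) c) := by
  have := Fintype.ofFinite (DIndex k m i)
  have h := posetSequence_d_basis b i a
  have h2 : (posetSequence k m b).entry i a c =
      (Algebra.TensorProduct.basis (MvPolynomial (Fin n) k) (DBasis k m b i)).repr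
        (posetDifferential k m i
          (Algebra.TensorProduct.basis (MvPolynomial (Fin n) k) (DBasis k m b (i + 1)) a)) c := rfl
  rw [h2, h, Module.Basis.repr_sum_self]

theorem repr_Dmap_DBasis (b : HomologyBases k m) (i : ℕ) (a : DIndex k m (i + 2))
    (c : DIndex k m (i + 1)) :
    (DBasis k m b (i + 1)).repr (Dmap k m (i + 1) (DBasis k m b (i + 2) a)) c =
      (b.basis c.1 i).repr (phi k m a.1 c.1 i (b.basis a.1 (i + 1) a.2)) c.2 := by
  rw [DBasis_succ_repr, summandProj_Dmap, DBasis_succ_apply,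
    Finset.sum_eq_single_of_mem a.1 (Finset.mem_univ _), summandProj_summandIncl_self]
  intro p _ hp
  rw [summandProj_summandIncl_of_ne hp, map_zero]

theorem posetDegree_lt_of_repr_ne_zero (b : HomologyBases k m) (i : ℕ) (a : DIndex k m (i + 1))
    (c : DIndex k m i)
    (h : (DBasis k m b i).repr (Dmap k m i (DBasis k m b (i + 1) a)) c ≠ 0) :
    posetDegree k m i c < posetDegree k m (i + 1) a := by
  rcases i with _ | i
  · exact lt_of_le_of_ne (zero_le (a := posetDegree k m 1 a)) a.1.2.2.symm
  · rw [repr_Dmap_DBasis] at h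
    by_contra hlt
    have h0 : phi k m a.1 c.1 i = 0 := dif_neg fun h' => hlt (mem_maxBelow.1 h').prop.2
    rw [h0, LinearMap.zero_apply, map_zero] at h
    exact h rfl

end Homogeneous

/-! ### The frame and its homogenization. -/

section Frame

variable {k : Type u} [Field k] {n r : ℕ} {m : Fin r → Fin n →₀ ℕ} {C : BettiComplex k m}

theorem BettiComplex.IsComparison.isFrame {f : (C.E → k) →ₗ[k] Chain k r} (hf : C.IsComparison f)
    (hm_ne : ∀ i, m i ≠ 0) (hm_min : ∀ i j, m i ≤ m j → i = j) (b : HomologyBases k m) :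
    IsFrame r (posetConstruction k m b) where
  finite i := finite_DIndex i
  bounded := ⟨r + 2, fun _ hi => isEmpty_DIndex hi⟩
  d_comp_d i x := hf.Dmap_Dmap i x
  card_zero := Nat.card_unique (α := Unit)
  card_one := by
    obtain ⟨w, -⟩ := exists_equiv_atoms k b hm_ne hm_min
    exact (Nat.card_congr w).trans (Nat.card_fin r)
  d_basis a o := Dmap_zero_DBasis b a o

/-- Induction on i: the lcm of the degrees occurring in φ of a basis element divides its degree p,
and equals p by `eq_of_phi_le`. -/
theorem BettiComplex.IsComparison.homogenizationDegree_eq {f : (C.E → k) →ₗ[k] Chain k r}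
    (hf : C.IsComparison f) (b : HomologyBases k m) (w : DIndex k m 1 → Fin r)
    (hw : ∀ a : DIndex k m 1, (a.1 : Fin n →₀ ℕ) = m (w a)) :
    ∀ i, homogenizationDegree m (posetConstruction k m b) w i = posetDegree k m i
  | 0 => rfl
  | 1 => funext fun a => (hw a).symm
  | i + 2 => by
    funext a
    change ((DBasis k m b (i + 1)).repr (Dmap k m (i + 1) (DBasis k m b (i + 2) a))).support.sup
      (homogenizationDegree m (posetConstruction k m b) w (i + 1)) = _
    rw [hf.homogenizationDegree_eq b w hw (i + 1)]
    have hx : b.basis a.1 (i + 1) a.2 ≠ 0 := (b.basis a.1 (i + 1)).ne_zero a.2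
    refine hf.eq_of_phi_le (p := a.1) hx (Finset.sup_le fun c hc => ?_) fun β hβ => ?_
    · exact (posetDegree_lt_of_repr_ne_zero b (i + 1) a c (Finsupp.mem_support_iff.1 hc)).le
    · obtain ⟨t, ht⟩ : ∃ t, (b.basis β i).repr (phi k m a.1 β i (b.basis a.1 (i + 1) a.2)) t ≠ 0 := by
        by_contra! h
        exact hβ ((b.basis β i).repr.map_eq_zero_iff.1 (Finsupp.ext h))
      rw [← repr_Dmap_DBasis b i a ⟨β, t⟩] at ht
      exact Finset.le_sup (f := posetDegree k m (i + 1)) (Finsupp.mem_support_iff.2 ht)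

theorem homogenization_d_single (U : BasedSeq k) (w : U.ι 1 → Fin r) (i : ℕ) [Fintype (U.ι i)]
    (v : U.ι (i + 1)) : (homogenization m U w).d i (Finsupp.single v (1 : MvPolynomial (Fin n) k)) =
      (∑ u, Finsupp.single u (monomial
        (homogenizationDegree m U w (i + 1) v - homogenizationDegree m U w i u)
        ((U.basis i).repr (U.d i (U.basis (i + 1) v)) u)) : U.ι i →₀ MvPolynomial (Fin n) k) := by
  refine (Finsupp.linearCombination_single (M := U.ι i →₀ MvPolynomial (Fin n) k)
    (MvPolynomial (Fin n) k) _ _).trans ?_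
  rw [one_smul]
  exact Finsupp.sum_fintype _ _ fun u => by rw [map_zero, Finsupp.single_zero]

theorem BettiComplex.IsComparison.equal_homogenization {f : (C.E → k) →ₗ[k] Chain k r}
    (hf : C.IsComparison f) (b : HomologyBases k m) (w : DIndex k m 1 → Fin r)
    (hw : ∀ a : DIndex k m 1, (a.1 : Fin n →₀ ℕ) = m (w a)) :
    (posetSequence k m b).Equal (homogenization m (posetConstruction k m b) w) := by
  have hdeg := hf.homogenizationDegree_eq b w hw
  let B := fun i => Algebra.TensorProduct.basis (MvPolynomial (Fin n) k) (DBasis k m b i)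
  have hB : ∀ i a, (B i).repr (B i a) = Finsupp.single a 1 := fun i a => (B i).repr_self a
  -- The homogenization is a free module on the same index set, so taking coordinates is the
  -- isomorphism.
  refine ⟨fun i => (B i).repr, fun i => Equiv.refl _, fun i x => ?_, fun i a => ⟨?_, ?_⟩⟩
  · have := Fintype.ofFinite (DIndex k m i)
    suffices h : (B i).repr.toLinearMap ∘ₗ posetDifferential k m i =
        (homogenization m (posetConstruction k m b) w).d i ∘ₗ (B (i + 1)).repr.toLinearMap from
      LinearMap.congr_fun h x
    refine (B (i + 1)).ext fun a => ?_
    refine (congrArg (B i).repr (posetSequence_d_basis b i a)).trans ?_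
    refine Eq.trans ?_ (congrArg ((homogenization m (posetConstruction k m b) w).d i)
      (hB (i + 1) a)).symm
    refine Eq.trans ?_
      (@homogenization_d_single _ _ _ _ m (posetConstruction k m b) w i
        (inferInstanceAs (Fintype (DIndex k m i))) a).symm
    rw [hdeg, hdeg, map_sum]
    refine Finset.sum_congr rfl fun u _ => ?_
    rw [map_smul]
    refine (congrArg _ (hB i u)).trans ?_
    rw [Finsupp.smul_single, smul_eq_mul, mul_one]
    rfl
  · exact (hB i a).trans (Finsupp.coe_basisSingleOne (R := MvPolynomial (Fin n) k) ▸ rfl)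
  · exact (congrFun (hdeg i) a).symm

theorem posetSequence_multigraded (b : HomologyBases k m) (i : ℕ) (a : DIndex k m (i + 1))
    (c : DIndex k m i) (h : (posetSequence k m b).entry i a c ≠ 0) :
    posetDegree k m i c ≤ posetDegree k m (i + 1) a ∧
      ∃ s : k, (posetSequence k m b).entry i a c =
        monomial (posetDegree k m (i + 1) a - posetDegree k m i c) s := by
  refine ⟨(posetDegree_lt_of_repr_ne_zero b i a c fun h0 => h ?_).le, _,
    posetSequence_entry b i a c⟩
  rw [posetSequence_entry, h0, map_zero]

end Frame


open MvPolynomial (constantCoeff)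

/-! ### Setting the variables to 1 in a minimal free resolution. -/

section Dehomogenization

variable {k : Type u} [Field k] {n r : ℕ} {m : Fin r → Fin n →₀ ℕ}

theorem monomial_mem_monomialIdeal {α : Fin n →₀ ℕ} (h : ∃ i, m i ≤ α) (c : k) :
    monomial α c ∈ monomialIdeal k m := by
  obtain ⟨i, hi⟩ := h
  have : monomial α c = monomial (α - m i) c * monomial (m i) (1 : k) := by
    rw [MvPolynomial.monomial_mul, tsub_add_cancel_of_le hi, mul_one]
  rw [this]
  exact Ideal.mul_mem_left _ _ (Ideal.subset_span ⟨i, rfl⟩)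

theorem monomialIdeal_le_ker (hm_ne : ∀ i, m i ≠ 0) :
    monomialIdeal k m ≤ RingHom.ker (constantCoeff : MvPolynomial (Fin n) k →+* k) := by
  refine Ideal.span_le.2 ?_
  rintro _ ⟨i, rfl⟩
  change constantCoeff (monomial (m i) (1 : k)) = 0
  rw [MvPolynomial.constantCoeff_monomial, if_neg (hm_ne i)]

theorem span_X_le_ker : Ideal.span (Set.range (MvPolynomial.X : Fin n → MvPolynomial (Fin n) k)) ≤
    RingHom.ker (constantCoeff : MvPolynomial (Fin n) k →+* k) := by
  refine Ideal.span_le.2 ?_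
  rintro _ ⟨i, rfl⟩
  exact MvPolynomial.constantCoeff_X (R := k) i

namespace LabelledSeq

variable {F : LabelledSeq k n}

/-- The coefficient of the monomial in an entry. -/
def coef (F : LabelledSeq k n) (i : ℕ) (a : F.ι (i + 1)) (b : F.ι i) : k :=
  MvPolynomial.eval 1 (F.entry i a b)

theorem IsComplex.entry_eq (hF : F.IsComplex) (i : ℕ) (a : F.ι (i + 1)) (b : F.ι i) :
    F.entry i a b = monomial (F.mdeg (i + 1) a - F.mdeg i b) (F.coef i a b) := by
  by_cases h : F.entry i a b = 0
  · rw [coef, h, map_zero, map_zero]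
  · obtain ⟨-, c, hc⟩ := hF.multigraded i a b h
    rw [coef, hc]
    congr 1
    simp [MvPolynomial.eval_monomial]

theorem IsComplex.le_of_coef_ne_zero (hF : F.IsComplex) {i : ℕ} {a : F.ι (i + 1)} {b : F.ι i}
    (h : F.coef i a b ≠ 0) : F.mdeg i b ≤ F.mdeg (i + 1) a :=
  (hF.multigraded i a b fun h0 => h (by rw [coef, h0, map_zero])).1

theorem d_basis (i : ℕ) [Fintype (F.ι i)] (a : F.ι (i + 1)) :
    F.d i (F.basis (i + 1) a) = ∑ b, F.entry i a b • F.basis i b :=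
  ((F.basis i).sum_repr _).symm

theorem repr_d (i : ℕ) [Fintype (F.ι (i + 1))] (x : F.X (i + 1)) (b : F.ι i) :
    (F.basis i).repr (F.d i x) b = ∑ a, (F.basis (i + 1)).repr x a * F.entry i a b := by
  nth_rewrite 1 [← (F.basis (i + 1)).sum_repr x]
  simp only [map_sum, map_smul, Finsupp.coe_finsetSum, Finset.sum_apply, Finsupp.smul_apply,
    smul_eq_mul]
  rfl

theorem IsMinimalFreeResolution.constantCoeff_repr_d {M : Ideal (MvPolynomial (Fin n) k)}
    (hF : F.IsMinimalFreeResolution M) (i : ℕ) (x : F.X (i + 1)) (b : F.ι i) :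
    constantCoeff ((F.basis i).repr (F.d i x) b) = 0 := by
  refine Submodule.smul_induction_on
    (p := fun z => constantCoeff ((F.basis i).repr z b) = 0) (hF.minimal i x)
    (fun s hs z _ => ?_) fun y z hy hz => ?_
  · have hs' : constantCoeff s = 0 := span_X_le_ker hs
    rw [map_smul, Finsupp.smul_apply, smul_eq_mul, map_mul, hs', zero_mul]
  · rw [map_add, Finsupp.add_apply, map_add, hy, hz, add_zero]

/-- Otherwise the basis element is a cycle, hence a boundary, with a coordinate equal to 1, against
minimality. -/
theorem IsMinimalFreeResolution.exists_entry_ne_zero {M : Ideal (MvPolynomial (Fin n) k)}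
    (hF : F.IsMinimalFreeResolution M) (i : ℕ) (a : F.ι (i + 1)) : ∃ b, F.entry i a b ≠ 0 := by
  by_contra! h
  have h0 : F.d i (F.basis (i + 1) a) = 0 :=
    (F.basis i).repr.map_eq_zero_iff.1 (Finsupp.ext h)
  obtain ⟨z, hz⟩ := (hF.exact i _).1 h0
  have := hF.constantCoeff_repr_d (i + 1) z a
  rw [hz, Module.Basis.repr_self, Finsupp.single_eq_same, map_one] at this
  exact one_ne_zero this

/-- Nakayama in degree 0: some basis element a has nonzero image in S/M → k, so it has degree 1
(exponent 0). Modulo a multiple of a, any other basis element lies in the kernel of ε, that is, in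
the image of d, yet has a coordinate equal to 1. -/
theorem IsMinimalFreeResolution.exists_unique_zero (hm_ne : ∀ i, m i ≠ 0)
    (hF : F.IsMinimalFreeResolution (monomialIdeal k m)) :
    ∃ a : F.ι 0, F.mdeg 0 a = 0 ∧ ∀ b, b = a := by
  have := hF.isComplex.finite 0
  have := Fintype.ofFinite (F.ι 0)
  obtain ⟨ε, hsurj, hex, hε⟩ := hF.augmentation
  choose c hc using hε
  -- The residue map to k exists because no generator is 1.
  let χ : MvPolynomial (Fin n) k ⧸ monomialIdeal k m →+* k :=
    Ideal.Quotient.lift _ constantCoeff fun a ha => monomialIdeal_le_ker hm_ne ha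
  have hχ : ∀ s, χ (Ideal.Quotient.mk _ s) = constantCoeff s := fun s =>
    Ideal.Quotient.lift_mk _ _ _
  have hsm : ∀ (s : MvPolynomial (Fin n) k) t, s • (Ideal.Quotient.mk (monomialIdeal k m) t) =
    Ideal.Quotient.mk _ (s * t) := fun s t => rfl
  obtain ⟨a, ha⟩ : ∃ a, χ (ε (F.basis 0 a)) ≠ 0 := by
    by_contra! h
    obtain ⟨x, hx⟩ := hsurj (Ideal.Quotient.mk _ 1)
    have h1 : χ (ε x) = 1 := by rw [hx, hχ, map_one]
    rw [← (F.basis 0).sum_repr x, map_sum, map_sum] at h1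
    refine zero_ne_one (h1 ▸ (Finset.sum_eq_zero fun a _ => ?_).symm)
    have := h a
    rw [hc, hχ] at this
    rw [map_smul, hc, hsm, hχ, map_mul, this, mul_zero]
  rw [hc, hχ, MvPolynomial.constantCoeff_monomial] at ha
  have hdeg : F.mdeg 0 a = 0 := by
    by_contra h
    rw [if_neg h] at ha
    exact ha rfl
  rw [if_pos hdeg] at ha
  refine ⟨a, hdeg, fun b => ?_⟩
  by_contra hb
  have h0 : ε (F.basis 0 b - monomial (F.mdeg 0 b) (c b / c a) • F.basis 0 a) = 0 := by
    rw [map_sub, map_smul, hc, hc, hsm, hdeg, MvPolynomial.monomial_mul, add_zero,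
      div_mul_cancel₀ _ ha, sub_self]
  obtain ⟨z, hz⟩ := (hex _).1 h0
  have := hF.constantCoeff_repr_d 0 z b
  rw [hz, map_sub, map_smul, Module.Basis.repr_self, Module.Basis.repr_self, Finsupp.sub_apply,
    Finsupp.smul_apply, Finsupp.single_eq_same, Finsupp.single_eq_of_ne hb, smul_zero,
    sub_zero, map_one] at this
  exact one_ne_zero this

theorem IsComplex.finite_sigma (hF : F.IsComplex) : Finite (Σ i, F.ι i) := by
  obtain ⟨N, hN⟩ := hF.bounded
  have := hF.finite
  refine Finite.of_surjective (α := Σ i : Fin N, F.ι i) (fun a => ⟨a.1, a.2⟩) ?_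
  rintro ⟨i, a⟩
  have hi : i < N := by
    by_contra h
    exact (hN i (not_lt.1 h)).false a
  exact ⟨⟨⟨i, hi⟩, a⟩, rfl⟩

/-- The differential of the dehomogenization. -/
def dehomD (F : LabelledSeq k n) [∀ i, Fintype (F.ι i)] :
    ((Σ i, F.ι i) → k) →ₗ[k] ((Σ i, F.ι i) → k) where
  toFun y e := ∑ a : F.ι (e.1 + 1), y ⟨e.1 + 1, a⟩ * F.coef e.1 a e.2
  map_add' x y := by
    funext e
    simp only [Pi.add_apply, add_mul, Finset.sum_add_distrib]
  map_smul' c x := by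
    funext e
    simp only [Pi.smul_apply, smul_eq_mul, mul_assoc, Finset.mul_sum, RingHom.id_apply]

section

variable [∀ i, Fintype (F.ι i)]

theorem dehomD_apply (y : (Σ i, F.ι i) → k) (i : ℕ) (b : F.ι i) :
    F.dehomD y ⟨i, b⟩ = ∑ a : F.ι (i + 1), y ⟨i + 1, a⟩ * F.coef i a b := rfl

theorem dehomD_single [DecidableEq (Σ i, F.ι i)] (i : ℕ) (a : F.ι (i + 1)) (b : F.ι i) :
    F.dehomD (Pi.single ⟨i + 1, a⟩ 1) ⟨i, b⟩ = F.coef i a b := by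
  rw [dehomD_apply, Finset.sum_eq_single_of_mem a (Finset.mem_univ _), Pi.single_eq_same, one_mul]
  intro a' _ ha'
  rw [Pi.single_eq_of_ne fun h => ha' (eq_of_heq (Sigma.mk.inj h).2), zero_mul]

theorem exists_of_dehomD_ne_zero [DecidableEq (Σ i, F.ι i)] {e e' : Σ i, F.ι i}
    (h : F.dehomD (Pi.single e 1) e' ≠ 0) :
    ∃ i a b, e = ⟨i + 1, a⟩ ∧ e' = ⟨i, b⟩ ∧ F.coef i a b ≠ 0 := by
  obtain ⟨i, b⟩ := e'
  rw [dehomD_apply] at h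
  obtain ⟨a, -, ha⟩ := Finset.exists_ne_zero_of_sum_ne_zero h
  have he : e = ⟨i + 1, a⟩ := by
    by_contra hne
    rw [Pi.single_eq_of_ne (Ne.symm hne), zero_mul] at ha
    exact ha rfl
  exact ⟨i, a, b, he, rfl, right_ne_zero_of_mul ha⟩

theorem IsComplex.dehomD_dehomD (hF : F.IsComplex) (y : (Σ i, F.ι i) → k) :
    F.dehomD (F.dehomD y) = 0 := by
  funext ⟨i, c⟩
  rw [dehomD_apply]
  simp only [dehomD_apply, Finset.sum_mul]
  rw [Finset.sum_comm]
  refine Finset.sum_eq_zero fun a _ => ?_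
  have h : (F.basis i).repr (F.d i (F.d (i + 1) (F.basis (i + 2) a))) c = 0 := by
    rw [hF.d_comp_d, map_zero, Finsupp.zero_apply]
  rw [repr_d] at h
  have h' := congrArg (MvPolynomial.eval (1 : Fin n → k)) h
  rw [map_sum, map_zero] at h'
  simp only [mul_assoc, ← Finset.mul_sum]
  refine mul_eq_zero_of_right _ (h' ▸ Finset.sum_congr rfl fun b _ => ?_)
  rw [map_mul]
  rfl

/-- The homogeneous element of degree `α` given by a family of coefficients. -/
def homogElt (F : LabelledSeq k n) [∀ i, Fintype (F.ι i)] (α : Fin n →₀ ℕ)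
    (y : (Σ i, F.ι i) → k) (i : ℕ) : F.X i :=
  ∑ b, monomial (α - F.mdeg i b) (y ⟨i, b⟩) • F.basis i b

theorem repr_homogElt (α : Fin n →₀ ℕ) (y : (Σ i, F.ι i) → k) (i : ℕ) (b : F.ι i) :
    (F.basis i).repr (F.homogElt α y i) b = monomial (α - F.mdeg i b) (y ⟨i, b⟩) := by
  rw [homogElt, Module.Basis.repr_sum_self]

/-- `homogElt` identifies vectors supported in degrees dividing α with the degree-α strand of F.
Without the support condition the truncated exponents would not add up. -/
theorem IsComplex.d_homogElt (hF : F.IsComplex) {α : Fin n →₀ ℕ} {y : (Σ i, F.ι i) → k}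
    (hy : ∀ e : Σ i, F.ι i, ¬ F.mdeg e.1 e.2 ≤ α → y e = 0) (i : ℕ) :
    F.d i (F.homogElt α y (i + 1)) = F.homogElt α (F.dehomD y) i := by
  refine (F.basis i).repr.injective (Finsupp.ext fun b => ?_)
  rw [repr_d, repr_homogElt, dehomD_apply, map_sum]
  refine Finset.sum_congr rfl fun a _ => ?_
  rw [repr_homogElt, hF.entry_eq, MvPolynomial.monomial_mul]
  by_cases h1 : F.coef i a b = 0
  · rw [h1, mul_zero, map_zero, map_zero]
  by_cases h2 : F.mdeg (i + 1) a ≤ α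
  · rw [tsub_add_tsub_cancel h2 (hF.le_of_coef_ne_zero h1)]
  · rw [hy ⟨i + 1, a⟩ h2, zero_mul, map_zero, map_zero]

/-- A preimage need not be homogeneous; its component of degree α is read off from the coefficient
of α/mdeg in each coordinate. -/
theorem IsComplex.exists_of_mem_range (hF : F.IsComplex) {α : Fin n →₀ ℕ}
    {y : (Σ i, F.ι i) → k} (hy : ∀ e : Σ i, F.ι i, ¬ F.mdeg e.1 e.2 ≤ α → y e = 0)
    (h : ∀ i, ∃ Z, F.d i Z = F.homogElt α y i) :
    ∃ z : (Σ i, F.ι i) → k, (∀ e : Σ i, F.ι i, ¬ F.mdeg e.1 e.2 ≤ α → z e = 0) ∧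
      F.dehomD z = y := by
  classical
  choose Z hZ using h
  -- The value in homological degree 0 is never read by `dehomD`.
  let z : (Σ i, F.ι i) → k := fun e => match e with
    | ⟨0, _⟩ => 0
    | ⟨i + 1, a⟩ => if F.mdeg (i + 1) a ≤ α then
        ((F.basis (i + 1)).repr (Z i) a).coeff (α - F.mdeg (i + 1) a) else 0
  refine ⟨z, ?_, funext ?_⟩
  · rintro ⟨_ | i, a⟩ he
    · rfl
    · exact if_neg he
  · rintro ⟨i, b⟩
    rw [dehomD_apply]
    by_cases hb : F.mdeg i b ≤ α
    · have h1 := congrArg (MvPolynomial.coeff (α - F.mdeg i b)) (repr_homogElt α y i b)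
      rw [MvPolynomial.coeff_monomial, if_pos rfl, ← hZ, repr_d, MvPolynomial.coeff_sum] at h1
      rw [← h1]
      refine Finset.sum_congr rfl fun a _ => ?_
      rw [hF.entry_eq, MvPolynomial.coeff_mul_monomial']
      change (if F.mdeg (i + 1) a ≤ α then _ else 0) * _ = _
      by_cases hc : F.coef i a b = 0
      · simp [hc]
      have hba := hF.le_of_coef_ne_zero hc
      by_cases ha : F.mdeg (i + 1) a ≤ α
      · rw [if_pos ha, if_pos (tsub_le_tsub_right ha _), tsub_tsub_tsub_cancel_right hba]
      · rw [if_neg ha, zero_mul, if_neg fun h' => ha ((tsub_le_tsub_iff_right hb).1 h')]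
    · rw [hy ⟨i, b⟩ hb]
      refine Finset.sum_eq_zero fun a _ => ?_
      change (if F.mdeg (i + 1) a ≤ α then _ else 0) * _ = _
      by_cases hc : F.coef i a b = 0
      · rw [hc, mul_zero]
      · rw [if_neg fun h' => hb ((hF.le_of_coef_ne_zero hc).trans h'), zero_mul]

theorem IsMinimalFreeResolution.exists_dehomD_eq (hm_ne : ∀ i, m i ≠ 0)
    (hF : F.IsMinimalFreeResolution (monomialIdeal k m)) {α : Fin n →₀ ℕ}
    {y : (Σ i, F.ι i) → k} (hy : ∀ e : Σ i, F.ι i, ¬ F.mdeg e.1 e.2 ≤ α → y e = 0)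
    (hD : F.dehomD y = 0) (h0 : (∀ a, y ⟨0, a⟩ = 0) ∨ ∃ i, m i ≤ α) :
    ∃ z : (Σ i, F.ι i) → k, (∀ e : Σ i, F.ι i, ¬ F.mdeg e.1 e.2 ≤ α → z e = 0) ∧
      F.dehomD z = y := by
  refine hF.isComplex.exists_of_mem_range hy fun i => ?_
  rcases i with _ | i
  · rcases h0 with h0 | h0
    · refine ⟨0, ?_⟩
      rw [map_zero, homogElt]
      refine (Finset.sum_eq_zero fun b _ => ?_).symm
      rw [h0, map_zero, zero_smul]
    -- The single generator in degree 0 is multiplied by a scalar times α, which lies in M, so ε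
    -- kills it.
    · obtain ⟨a, ha, huniq⟩ := hF.exists_unique_zero hm_ne
      obtain ⟨ε, -, hex, -⟩ := hF.augmentation
      refine (hex _).1 ?_
      rw [homogElt, map_sum]
      refine Finset.sum_eq_zero fun b _ => ?_
      obtain rfl := huniq b
      obtain ⟨t, ht⟩ := Ideal.Quotient.mk_surjective (ε (F.basis 0 b))
      rw [map_smul, ← ht, ha, tsub_zero]
      exact Ideal.Quotient.eq_zero_iff_mem.2
        (Ideal.mul_mem_right _ _ (monomial_mem_monomialIdeal h0 _))
  · refine (hF.exact i _).1 ?_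
    rw [hF.isComplex.d_homogElt hy, hD, homogElt]
    refine Finset.sum_eq_zero fun b _ => ?_
    rw [Pi.zero_apply, map_zero, zero_smul]

end

open Classical in
/-- The dehomogenization of a Betti-linear resolution. -/
def IsMinimalFreeResolution.bettiComplex (hm_ne : ∀ i, m i ≠ 0)
    (hF : F.IsMinimalFreeResolution (monomialIdeal k m)) [∀ i, Fintype (F.ι i)]
    (hlin : ∀ i a b, F.entry i a b ≠ 0 →
      CoversIn (bettiPoset k m) (F.mdeg i b) (F.mdeg (i + 1) a)) : BettiComplex k m :=
  haveI := hF.isComplex.finite_sigma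
  haveI : Fintype (Σ i, F.ι i) := Fintype.ofFinite _
  { E := Σ i, F.ι i
    deg := fun e => F.mdeg e.1 e.2
    dim := fun e => e.1
    D := F.dehomD
    bot := ⟨0, (hF.exists_unique_zero hm_ne).choose⟩
    D_D := hF.isComplex.dehomD_dehomD
    dim_eq := fun e e' h => by
      obtain ⟨i, a, b, rfl, rfl, -⟩ := exists_of_dehomD_ne_zero h
      rfl
    covers := fun e e' h => by
      obtain ⟨i, a, b, rfl, rfl, h'⟩ := exists_of_dehomD_ne_zero h
      exact hlin i a b fun h0 => h' (by rw [coef, h0, map_zero])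
    dim_eq_zero := fun e => by
      constructor
      · obtain ⟨i, a⟩ := e
        rintro rfl
        exact congrArg _ ((hF.exists_unique_zero hm_ne).choose_spec.2 a)
      · rintro rfl
        rfl
    deg_bot := (hF.exists_unique_zero hm_ne).choose_spec.1
    deg_mem := fun e he => by
      obtain ⟨_ | i, a⟩ := e
      · exact absurd rfl he
      -- Some entry is nonzero by minimality, and Betti-linearity then puts the degree in the Betti
      -- poset, strictly above another.
      · obtain ⟨b, hb⟩ := hF.exists_entry_ne_zero i a
        obtain ⟨_, h2, hlt⟩ := hlin i a b hb
        have h' : F.mdeg i b < F.mdeg (i + 1) a := hlt.lt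
        exact ⟨h2, ((zero_le (a := F.mdeg i b)).trans_lt h').ne'⟩
    exact := fun α y hy hD h0 => hF.exists_dehomD_eq hm_ne hy hD (h0.imp_left fun h a => by
      rw [(hF.exists_unique_zero hm_ne).choose_spec.2 a]
      exact h) }

end LabelledSeq

end Dehomogenization

/-! ### Carrying the resolution over to 𝓕(L_M). -/

section Transfer

variable {k : Type u} [Field k] {n r : ℕ} {m : Fin r → Fin n →₀ ℕ}

/-- The isomorphism need not match bases except in degree 0, where the augmentation refers to them;
multigradedness with respect to the new bases is therefore a separate hypothesis. -/
theorem LabelledSeq.IsMinimalFreeResolution.of_equiv {F G : LabelledSeq k n}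
    {M : Ideal (MvPolynomial (Fin n) k)} (hF : F.IsMinimalFreeResolution M)
    (Θ : ∀ i, F.X i ≃ₗ[MvPolynomial (Fin n) k] G.X i)
    (hΘ : ∀ i x, Θ i (F.d i x) = G.d i (Θ (i + 1) x))
    (h0 : ∀ a, ∃ a', Θ 0 (F.basis 0 a') = G.basis 0 a ∧ F.mdeg 0 a' = G.mdeg 0 a)
    (finite : ∀ i, Finite (G.ι i)) (bounded : ∃ N, ∀ i, N ≤ i → IsEmpty (G.ι i))
    (multigraded : ∀ i a b, G.entry i a b ≠ 0 → G.mdeg i b ≤ G.mdeg (i + 1) a ∧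
      ∃ c : k, G.entry i a b = monomial (G.mdeg (i + 1) a - G.mdeg i b) c) :
    G.IsMinimalFreeResolution M where
  isComplex :=
    { finite := finite
      bounded := bounded
      multigraded := multigraded
      d_comp_d := fun i x => by
        obtain ⟨x, rfl⟩ := (Θ (i + 2)).surjective x
        rw [← hΘ, ← hΘ, hF.isComplex.d_comp_d, map_zero] }
  exact i x := by
    obtain ⟨x, rfl⟩ := (Θ (i + 1)).surjective x
    rw [← hΘ, LinearEquiv.map_eq_zero_iff, hF.exact i x]
    constructor
    · rintro ⟨z, rfl⟩
      exact ⟨Θ (i + 2) z, (hΘ _ _).symm⟩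
    · rintro ⟨z, hz⟩
      obtain ⟨z, rfl⟩ := (Θ (i + 2)).surjective z
      exact ⟨z, (Θ (i + 1)).injective ((hΘ _ _).trans hz)⟩
  augmentation := by
    obtain ⟨ε, hs, hex, hε⟩ := hF.augmentation
    refine ⟨ε ∘ₗ (Θ 0).symm.toLinearMap, hs.comp (Θ 0).symm.surjective, fun x => ?_, fun a => ?_⟩
    · obtain ⟨x, rfl⟩ := (Θ 0).surjective x
      rw [LinearMap.comp_apply, LinearEquiv.coe_coe, LinearEquiv.symm_apply_apply, hex x]
      constructor
      · rintro ⟨z, rfl⟩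
        exact ⟨Θ 1 z, (hΘ _ _).symm⟩
      · rintro ⟨z, hz⟩
        obtain ⟨z, rfl⟩ := (Θ 1).surjective z
        exact ⟨z, (Θ 0).injective ((hΘ _ _).trans hz)⟩
    · obtain ⟨a', ha', hdeg⟩ := h0 a
      obtain ⟨c, hc⟩ := hε a'
      refine ⟨c, ?_⟩
      rw [LinearMap.comp_apply, LinearEquiv.coe_coe, ← ha', LinearEquiv.symm_apply_apply, hc, hdeg]
  minimal i x := by
    obtain ⟨x, rfl⟩ := (Θ (i + 1)).surjective x
    have h := Submodule.mem_map_of_mem (f := (Θ i).toLinearMap) (hF.minimal i x)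
    rw [Submodule.map_smul'', Submodule.map_top, LinearEquiv.range] at h
    rw [← hΘ]
    exact h

theorem BettiComplex.IsComparison.isHomogeneousOf_basis {C : BettiComplex k m}
    {f : (C.E → k) →ₗ[k] Chain k r} (hf : C.IsComparison f) (i : ℕ)
    (e : {e : C.E // C.dim e = i}) : IsHomogeneousOf k m i (hf.basis i e) (C.deg e) := by
  classical
  rcases i with _ | i
  · change C.deg e = 0
    rw [(C.dim_eq_zero e).1 e.2, C.deg_bot]
  · intro p hp
    rw [hf.basis_apply, hf.summandProj_toDSpace, ← hf.theta_piece]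
    have : C.piece p (i + 1) (Pi.single (e : C.E) (1 : k)) = 0 := by
      funext e'
      rw [piece_apply]
      split_ifs with h
      · rw [Pi.single_eq_of_ne fun h' => hp (by rw [← h.1, h'])]
        rfl
      · rfl
    rw [this, map_zero]

/-- The basis of F gives a homogeneous basis B of 𝓓(L_M) through `toDSpace`. In it the differential
of 𝓕(L_M) has the entries of F, so matching bases is an isomorphism of complexes, whatever the
homology bases b are. -/
theorem isMinimalFreeResolution_posetSequence (hm_ne : ∀ i, m i ≠ 0) (b : HomologyBases k m)
    {F : LabelledSeq k n} (hF : F.IsMinimalFreeResolution (monomialIdeal k m))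
    [∀ i, Fintype (F.ι i)] (hlin : ∀ i a b, F.entry i a b ≠ 0 →
      CoversIn (bettiPoset k m) (F.mdeg i b) (F.mdeg (i + 1) a))
    {f : ((hF.bettiComplex hm_ne hlin).E → k) →ₗ[k] Chain k r}
    (hf : (hF.bettiComplex hm_ne hlin).IsComparison f) :
    (posetSequence k m b).IsMinimalFreeResolution (monomialIdeal k m) := by
  set C := hF.bettiComplex hm_ne hlin with hC
  let el : ∀ i, F.ι i → {e : C.E // C.dim e = i} := fun i a => ⟨⟨i, a⟩, rfl⟩
  have hel : ∀ i, Function.Bijective (el i) := fun i => by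
    constructor
    · intro a a' h
      exact eq_of_heq (Sigma.mk.inj (congrArg Subtype.val h)).2
    · rintro ⟨⟨j, a⟩, rfl⟩
      exact ⟨a, rfl⟩
  let B : ∀ i, Module.Basis (F.ι i) k (DSpace k m i) := fun i =>
    (hf.basis i).reindex (Equiv.ofBijective (el i) (hel i)).symm
  have hB : ∀ i a, B i a = hf.toDSpace i (Pi.single (⟨i, a⟩ : Σ i, F.ι i) 1) := fun i a => by
    rw [Module.Basis.reindex_apply, Equiv.symm_symm, hf.basis_apply]
    rfl
  have hBh : ∀ i a, IsHomogeneousOf k m i (B i a) (F.mdeg i a) := fun i a => by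
    rw [Module.Basis.reindex_apply, Equiv.symm_symm]
    exact hf.isHomogeneousOf_basis i (el i a)
  have hBr : ∀ i y a, (B i).repr (hf.toDSpace i y) a = y (⟨i, a⟩ : Σ i, F.ι i) := fun i y a => by
    rw [Module.Basis.repr_reindex_apply, Equiv.symm_symm]
    exact hf.basis_repr i y (el i a)
  let TB := fun i => Algebra.TensorProduct.basis (MvPolynomial (Fin n) k) (B i)
  let Θ : ∀ i, F.X i ≃ₗ[MvPolynomial (Fin n) k] MvPolynomial (Fin n) k ⊗[k] DSpace k m i :=
    fun i => (F.basis i).equiv (TB i) (Equiv.refl _)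
  have hΘb : ∀ i a, Θ i (F.basis i a) = TB i a := fun i a =>
    (F.basis i).equiv_apply _ _ _
  refine hF.of_equiv Θ (fun i x => ?_) (fun o => ?_) (fun i => finite_DIndex i)
    ⟨r + 2, fun _ hi => isEmpty_DIndex hi⟩ (posetSequence_multigraded b)
  · suffices h : (Θ i).toLinearMap ∘ₗ F.d i =
        posetDifferential k m i ∘ₗ (Θ (i + 1)).toLinearMap from LinearMap.congr_fun h x
    refine (F.basis (i + 1)).ext fun a => ?_
    rw [LinearMap.comp_apply, LinearMap.comp_apply, LinearEquiv.coe_coe, LinearEquiv.coe_coe, hΘb,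
      LabelledSeq.d_basis, map_sum, Algebra.TensorProduct.basis_apply,
      posetDifferential_eq_sum (hBh (i + 1) a) (B i) (F.mdeg i) (hBh i)]
    refine Finset.sum_congr rfl fun u _ => ?_
    rw [map_smul, hΘb, hB, hf.Dmap_toDSpace, hBr, hF.isComplex.entry_eq]
    congr 2
    exact (@LabelledSeq.dehomD_single _ _ _ F _ C.decidableEq i a u).symm
  -- In degree 0 both bases consist of the class of the empty face, with multidegree 1.
  · refine ⟨(hF.exists_unique_zero hm_ne).choose, (hΘb _ _).trans ?_,
      (hF.exists_unique_zero hm_ne).choose_spec.1⟩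
    have : B 0 (hF.exists_unique_zero hm_ne).choose = DBasis k m b 0 o := by
      refine (hB _ _).trans ?_
      refine Eq.trans ?_ b.bottom_empty.symm
      exact (congrArg (· • _) (Pi.single_eq_same (M := fun _ => k) C.bot 1)).trans (one_smul _ _)
    exact ((Algebra.TensorProduct.basis_apply _ _).trans
      (congrArg (fun x => (1 : MvPolynomial (Fin n) k) ⊗ₜ[k] x) this)).trans
      (Algebra.TensorProduct.basis_apply _ _).symm

end Transfer

end PosetResolution
end

/-! ### The theorem. -/

theorem mainTheorem6 {k : Type*} [Field k] {n r : ℕ} (m : Fin r → Fin n →₀ ℕ)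
    (hm_ne : ∀ i, m i ≠ 0) (hm_min : ∀ i j, m i ≤ m j → i = j)
    (hM : PosetResolution.BettiLinear k m) (b : PosetResolution.HomologyBases k m) :
    (∀ p c, Function.Bijective (PosetResolution.sigma k m p c)) ∧
    PosetResolution.IsFrame r (PosetResolution.posetConstruction k m b) ∧
    (∃ w : (PosetResolution.posetConstruction k m b).ι 1 ≃ Fin r,
      (∀ a, (PosetResolution.posetSequence k m b).mdeg 1 a = m (w a)) ∧
      (PosetResolution.posetSequence k m b).Equal
        (PosetResolution.homogenization m (PosetResolution.posetConstruction k m b) w)) ∧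
    (PosetResolution.posetSequence k m b).IsMinimalFreeResolution
      (PosetResolution.monomialIdeal k m) := by
  obtain ⟨F, hF, hlin⟩ := hM
  have := hF.isComplex.finite
  have := fun i => Fintype.ofFinite (F.ι i)
  obtain ⟨f, hf⟩ := (hF.bettiComplex hm_ne hlin).exists_comparison
  obtain ⟨w, hw⟩ := PosetResolution.exists_equiv_atoms k b hm_ne hm_min
  exact ⟨hf.sigma_bijective, hf.isFrame hm_ne hm_min b, ⟨w, hw, hf.equal_homogenization b w hw⟩,
    PosetResolution.isMinimalFreeResolution_posetSequence hm_ne b hF hlin hf⟩
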